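/- Write $I=[0,1)$. Let $r_0$ be the $1$-periodic function equal to $1$ on $[0,1/2)$ and $-1$ on $[1/2,1)$, $r_n(x)=r_0(2^nx)$, and let $w_k$ be the Walsh functions: $w_0=1$ and $w_k=r_{n_1}\cdots r_{n_s}$ if $k=2^{n_1}+\cdots+2^{n_s}$ with $n_1>\cdots>n_s\ge 0$. For $f\in L^1(I^2)$ put $$\hat f(m,n)=\int_{I^2}f(s,t)w_m(s)w_n(t)\,ds\,dt,\qquad S_{M,N}(x,y;f)=\sum_{m=0}^{M-1}\sum_{n=0}^{N-1}\hat f(m,n)w_m(x)w_n(y),$$ and, for $a,b$ real and not negative integers, let $$\sigma^{a,b}_{n,m}(x,y;f)=\frac1{A^{a}_{n-1}A^{b}_{m-1}}\sum_{i=1}^n\sum_{j=1}^m A^{a-1}_{n-i}A^{b-1}_{m-j}S_{i,j}(x,y;f),\qquad A_0^{a}=1,\quad A_n^{a}=\frac{(a+1)\cdots(a+n)}{n!},$$ be the Cesàro $(C;a,b)$-means of the double Walsh–Fourier series of $f$. For a real function $f$ on $I^2$ and $n\ge 1$ let $$v_1^\#(f;n)=\sup\sum_{i=1}^n|f(b_i,y_i)-f(a_i,y_i)|,\qquad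 v_2^\#(f;n)=\sup\sum_{i=1}^n|f(y_i,b_i)-f(y_i,a_i)|,$$ where the suprema (possibly $+\infty$) are taken over all points $y_1,\dots,y_n\in I$ and all collections, in arbitrary order, of $n$ nonoverlapping intervals $(a_i,b_i)$ with $a_i,b_i\in I$, $a_i<b_i$. For $x,h\in I$ with dyadic digits $x_k,h_k$ (dyadic rationals being given their terminating expansion) put $x\dotplus h=\sum_{k\ge0}|x_k-h_k|2^{-(k+1)}$. Say that $f$ is continuous at $(x,y)\in I^2$ if $f(x\dotplus h,y\dotplus\delta)\to f(x,y)$ as $(h,\delta)\to(0,0)$ with $h,\delta\in I$. **Theorem.** Let $\alpha,\beta\in(0,1)$ with $\alpha+\beta<1$, and let $f:I^2\to\mathbb R$ be a (Lebesgue) measurable function such that $$\sum_{j=1}^\infty\frac{v_s^\#(f;2^j)}{2^{j(1-(\alpha+\beta))}}<\infty,\qquad s=1,2.$$ Then, at every point $(x,y)\in I^2$ at which $f$ is continuous in the above sense, $$\sigma^{-\alpha,-\beta}_{n,m}(x,y;f)\to f(x,y)\qquad\text{as } n,m\to\infty \text{ independently}.$$ -/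

import Mathlib

open MeasureTheory Set Filter Topology
open scoped ENNReal

namespace DoubleWalsh

/-- The unit interval `[0,1)`. -/
def I : Set ℝ := Ico 0 1

/-- The unit square `[0,1)²`. -/
def I2 : Set (ℝ × ℝ) := I ×ˢ I

/-! ### Walsh functions and the double Walsh–Fourier series -/

/-- The `1`-periodic function equal to `1` on `[0,1/2)` and to `-1` on `[1/2,1)`. -/
noncomputable def r0 (x : ℝ) : ℝ := if Int.fract x < 1 / 2 then 1 else -1

/-- The Rademacher functions `r_n(x) = r_0(2^n x)`. -/
noncomputable def rademacher (n : ℕ) (x : ℝ) : ℝ := r0 (2 ^ n * x)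

/-- The Walsh functions in the Paley enumeration: if `k = 2^{n_1} + ⋯ + 2^{n_s}` with distinct
`n_1, …, n_s` (the list `k.bitIndices`), then `w_k = r_{n_1} ⋯ r_{n_s}`; in particular
`w_0 = 1`. -/
noncomputable def walsh (k : ℕ) (x : ℝ) : ℝ := (k.bitIndices.map fun i => rademacher i x).prod

/-- The `(n,m)`-th Walsh–Fourier coefficient of `f`. -/
noncomputable def coeff (f : ℝ → ℝ → ℝ) (n m : ℕ) : ℝ :=
  ∫ p in I2, f p.1 p.2 * walsh n p.1 * walsh m p.2

/-- The rectangular partial sums `S_{M,N}(x,y;f)`. -/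
noncomputable def partialSum (f : ℝ → ℝ → ℝ) (M N : ℕ) (x y : ℝ) : ℝ :=
  ∑ m ∈ Finset.range M, ∑ n ∈ Finset.range N, coeff f m n * walsh m x * walsh n y

/-- The Cesàro numbers `A_n^a = (a+1)⋯(a+n)/n!`, with `A_0^a = 1`. -/
noncomputable def cesaroNumber (a : ℝ) (n : ℕ) : ℝ :=
  (∏ k ∈ Finset.Icc 1 n, (a + k)) / (n.factorial : ℝ)

/-- The Cesàro `(C;a,b)`-means `σ_{n,m}^{a,b}(x,y;f)`, for `n, m ≥ 1`. -/
noncomputable def cesaroMean (a b : ℝ) (f : ℝ → ℝ → ℝ) (n m : ℕ) (x y : ℝ) : ℝ :=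
  (1 / (cesaroNumber a (n - 1) * cesaroNumber b (m - 1))) *
    ∑ i ∈ Finset.Icc 1 n, ∑ j ∈ Finset.Icc 1 m,
      cesaroNumber (a - 1) (n - i) * cesaroNumber (b - 1) (m - j) * partialSum f i j x y

/-! ### Dyadic addition and continuity -/

/-- The digit `x_k` in `x = ∑ x_k 2^{-(k+1)}` for `x ∈ [0,1)`, where for dyadic rationals
the terminating expansion is taken. -/
noncomputable def digit (x : ℝ) (k : ℕ) : ℕ := ⌊2 ^ (k + 1) * x⌋₊ % 2

/-- The dyadic sum `x ∔ y = ∑ |x_k - y_k| 2^{-(k+1)}`. -/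
noncomputable def dyadicAdd (x y : ℝ) : ℝ :=
  ∑' k : ℕ, |(digit x k : ℝ) - (digit y k : ℝ)| * ((2 : ℝ) ^ (k + 1))⁻¹

/-- Continuity at `(x,y)`: `f(x ∔ h, y ∔ δ) → f(x,y)` as `(h,δ) → (0,0)` in `[0,1)²`. -/
def DyadicContinuousAt (f : ℝ → ℝ → ℝ) (x y : ℝ) : Prop :=
  Tendsto (fun q : ℝ × ℝ => f (dyadicAdd x q.1) (dyadicAdd y q.2)) (𝓝[I2] (0, 0)) (𝓝 (f x y))

/-! ### The moduli of variation -/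

/-- `(a i, b i)`, `i < n`, is a collection (in arbitrary order) of `n` nonoverlapping
nondegenerate intervals with endpoints in `[0,1)`. -/
def Nonoverlapping {n : ℕ} (a b : Fin n → ℝ) : Prop :=
  (∀ i, a i ∈ I ∧ b i ∈ I ∧ a i < b i) ∧
    Pairwise fun i j => Disjoint (Ioo (a i) (b i)) (Ioo (a j) (b j))

/-- `v_1^#(f;n)`, the supremum of `∑ |f(b_i,y_i) - f(a_i,y_i)|` over `n` points `y_i` and `n`
nonoverlapping intervals `(a_i,b_i)`; possibly `∞`. -/
noncomputable def vSharp1 (f : ℝ → ℝ → ℝ) (n : ℕ) : ℝ≥0∞ :=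
  ⨆ (y : Fin n → ℝ) (_ : ∀ i, y i ∈ I) (a : Fin n → ℝ) (b : Fin n → ℝ)
    (_ : Nonoverlapping a b), ∑ i, ENNReal.ofReal |f (b i) (y i) - f (a i) (y i)|

/-- `v_2^#(f;n)`, the supremum of `∑ |f(x_j,d_j) - f(x_j,c_j)|` over `n` points `x_j` and `n`
nonoverlapping intervals `(c_j,d_j)`; possibly `∞`. -/
noncomputable def vSharp2 (f : ℝ → ℝ → ℝ) (n : ℕ) : ℝ≥0∞ :=
  ⨆ (x : Fin n → ℝ) (_ : ∀ j, x j ∈ I) (c : Fin n → ℝ) (d : Fin n → ℝ)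
    (_ : Nonoverlapping c d), ∑ j, ENNReal.ofReal |f (x j) (d j) - f (x j) (c j)|

end DoubleWalsh

namespace DoubleWalsh

/-! ### Cesàro numbers of negative order -/

/-! Take dyadic grids of mesh `2^{-R}` and `2^{-S}` with `2^{R-1} ≤ n < 2^R` and `2^{S-1} ≤ m <
2^S`. The Walsh functions occurring in the mean are constant on grid cells, so the mean minus
`f(x,y)` is an average, over all offsets of the grids, of double sums of `f - f(x,y)` at dyadically
translated grid points against a product of two discrete kernels of total mass 1
(`cesaroMean_sub_eq_integral`). No L¹ bound for the kernels is used, only the decay of their tails: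
the mass beyond index `j` is `O(2^{-(1-α) size j})`, uniformly in `n` (`exists_abs_kernelTail_le`).
Double summation by parts (`sum_sum_mul_eq`) therefore leaves mixed differences of `f` with weights
of order `i^{α-1} j^{β-1}`.

The corner `i, j < 2^L` is small by continuity. The other pairs are grouped by the size `a > L` of
the larger index, say `i`. For fixed `j` the mixed differences sum to at most twice the variation of
`f` along a translated grid, which is at most `∑_{p<a} v₁^#(f; 2^p)` (`sum_Ico_abs_sub_le`); the
weights contribute `2^{a(α-1)}` from `i` and `O(2^{aβ})` from the sum over `j`. The result is a tail
of `∑_a 2^{-a(1-α-β)} ∑_{p<a} v₁^#(f; 2^p)`, which converges by hypothesis since `α + β < 1`.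

The tail decay comes from two facts. For `k` in `[2^p, 2^{p+1})` the tail of `w_k` at `j` is
`w_{k-2^p}(j)` times a factor that is `O(2^{-p})` and independent of `k`. And the Dirichlet kernel
of order `2^l` vanishes on `[2^{-l}, 1)`, so sums of `w_k` against the monotone Cesàro numbers
cancel in blocks of length `2^l`. -/

@[simp] lemma cesaroNumber_zero (a : ℝ) : cesaroNumber a 0 = 1 := by
  simp [cesaroNumber]

lemma cesaroNumber_succ (a : ℝ) (n : ℕ) :
    cesaroNumber a (n + 1) = cesaroNumber a n * ((a + (n + 1)) / (n + 1)) := by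
  have h : (n.factorial : ℝ) ≠ 0 := by positivity
  simp only [cesaroNumber]
  rw [Finset.prod_Icc_succ_top (by omega), Nat.factorial_succ]
  push_cast
  field_simp

lemma cesaroNumber_sub_one_succ (a : ℝ) (n : ℕ) :
    cesaroNumber (a - 1) (n + 1) = cesaroNumber a n * (a / (n + 1)) := by
  induction n with
  | zero => rw [cesaroNumber_succ]; simp
  | succ n ih =>
    rw [cesaroNumber_succ, ih, cesaroNumber_succ a n]
    push_cast
    have : (n : ℝ) + 1 ≠ 0 := by positivity
    have : (n : ℝ) + 1 + 1 ≠ 0 := by positivity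
    field_simp
    ring

lemma sum_cesaroNumber_sub_one (a : ℝ) (n : ℕ) :
    ∑ i ∈ Finset.range (n + 1), cesaroNumber (a - 1) i = cesaroNumber a n := by
  induction n with
  | zero => simp
  | succ n ih =>
    rw [Finset.sum_range_succ, ih, cesaroNumber_sub_one_succ, cesaroNumber_succ]
    have : (n : ℝ) + 1 ≠ 0 := by positivity
    field_simp
    ring

section
variable {α : ℝ}

lemma cesaroNumber_neg_succ (α : ℝ) (n : ℕ) :
    cesaroNumber (-α) (n + 1) = cesaroNumber (-α) n * (1 - α / (n + 1)) := by
  rw [cesaroNumber_succ]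
  have : (n : ℝ) + 1 ≠ 0 := by positivity
  field_simp
  ring

lemma one_sub_div_pos (hα : α ∈ Ioo (0 : ℝ) 1) (n : ℕ) : 0 < 1 - α / ((n : ℝ) + 1) := by
  have h : α / ((n : ℝ) + 1) < 1 := by
    rw [div_lt_one (by positivity)]
    have := n.cast_nonneg (α := ℝ)
    linarith [hα.2]
  linarith

lemma cesaroNumber_neg_pos (hα : α ∈ Ioo (0 : ℝ) 1) (n : ℕ) : 0 < cesaroNumber (-α) n := by
  induction n with
  | zero => simp
  | succ n ih => rw [cesaroNumber_neg_succ]; exact mul_pos ih (one_sub_div_pos hα n)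

lemma cesaroNumber_neg_antitone (hα : α ∈ Ioo (0 : ℝ) 1) : Antitone (cesaroNumber (-α)) := by
  refine antitone_nat_of_succ_le fun n => ?_
  rw [cesaroNumber_neg_succ]
  have h := cesaroNumber_neg_pos hα n
  have h2 : 0 ≤ α / ((n : ℝ) + 1) := div_nonneg hα.1.le (by positivity)
  nlinarith

/-- The product decreases in `n`: by Bernoulli, consecutive ratios are at most `(1 - t)(1 + t) ≤ 1`
with `t = α/(n+1)`. -/
lemma cesaroNumber_neg_mul_rpow_le (hα : α ∈ Ioo (0 : ℝ) 1) (n : ℕ) :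
    cesaroNumber (-α) n * ((n : ℝ) + 1) ^ α ≤ 1 := by
  induction n with
  | zero => simp
  | succ n ih =>
    refine le_trans ?_ ih
    have hn : (0 : ℝ) < (n : ℝ) + 1 := by positivity
    have h1 : (((n + 1 : ℕ) : ℝ) + 1) ^ α
        ≤ ((n : ℝ) + 1) ^ α * (1 + α * (1 / ((n : ℝ) + 1))) := by
      have e : ((n + 1 : ℕ) : ℝ) + 1 = ((n : ℝ) + 1) * (1 + 1 / ((n : ℝ) + 1)) := by
        push_cast; field_simp
      rw [e, Real.mul_rpow hn.le (by positivity)]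
      gcongr
      exact rpow_one_add_le_one_add_mul_self (by have : 0 ≤ 1 / ((n : ℝ) + 1) := by positivity
                                                 linarith) hα.1.le hα.2.le
    have hA := cesaroNumber_neg_pos hα n
    have hA' := cesaroNumber_neg_pos hα (n + 1)
    calc cesaroNumber (-α) (n + 1) * (((n + 1 : ℕ) : ℝ) + 1) ^ α
        ≤ cesaroNumber (-α) (n + 1) * (((n : ℝ) + 1) ^ α * (1 + α * (1 / ((n : ℝ) + 1)))) := by
          gcongr
      _ = cesaroNumber (-α) n * ((n : ℝ) + 1) ^ α * (1 - (α / (n + 1)) ^ 2) := by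
          rw [cesaroNumber_neg_succ]; field_simp; ring
      _ ≤ cesaroNumber (-α) n * ((n : ℝ) + 1) ^ α * 1 := by
          gcongr
          linarith [sq_nonneg (α / ((n : ℝ) + 1))]
      _ = _ := mul_one _

lemma le_cesaroNumber_neg_mul_rpow (hα : α ∈ Ioo (0 : ℝ) 1) (n : ℕ) :
    1 - α ≤ cesaroNumber (-α) n * ((n : ℝ) + 1) ^ α := by
  -- With base `n` instead of `n + 1` the product increases, by Bernoulli at a negative increment,
  -- and it starts at `1 - α` for index 1.
  have key : ∀ n : ℕ, 1 - α ≤ cesaroNumber (-α) (n + 1) * ((n + 1 : ℕ) : ℝ) ^ α := by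
    intro n
    induction n with
    | zero => rw [cesaroNumber_neg_succ]; simp
    | succ n ih =>
      refine ih.trans ?_
      have hn : (0 : ℝ) < ((n + 1 + 1 : ℕ) : ℝ) := by positivity
      have h1 : ((n + 1 : ℕ) : ℝ) ^ α
          ≤ ((n + 1 + 1 : ℕ) : ℝ) ^ α * (1 - α / (((n + 1 : ℕ) : ℝ) + 1)) := by
        have e : ((n + 1 : ℕ) : ℝ) = ((n + 1 + 1 : ℕ) : ℝ) * (1 + -(1 / ((n : ℝ) + 2))) := by
          push_cast; field_simp; ring
        have hb : 1 / ((n : ℝ) + 2) ≤ 1 := by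
          rw [div_le_one (by positivity)]; linarith [n.cast_nonneg (α := ℝ)]
        calc ((n + 1 : ℕ) : ℝ) ^ α
            = ((n + 1 + 1 : ℕ) : ℝ) ^ α * (1 + -(1 / ((n : ℝ) + 2))) ^ α := by
              conv_lhs => rw [e]
              rw [Real.mul_rpow hn.le (by linarith)]
          _ ≤ ((n + 1 + 1 : ℕ) : ℝ) ^ α * (1 + α * -(1 / ((n : ℝ) + 2))) := by
              gcongr
              exact rpow_one_add_le_one_add_mul_self (by linarith) hα.1.le hα.2.le
          _ = _ := by push_cast; ring
      have hA := cesaroNumber_neg_pos hα (n + 1)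
      calc _ ≤ cesaroNumber (-α) (n + 1) *
            (((n + 1 + 1 : ℕ) : ℝ) ^ α * (1 - α / (((n + 1 : ℕ) : ℝ) + 1))) := by gcongr
        _ = _ := by rw [cesaroNumber_neg_succ α (n + 1)]; ring
  cases n with
  | zero => simpa using hα.1.le
  | succ n =>
    refine (key n).trans ?_
    have hA := cesaroNumber_neg_pos hα (n + 1)
    gcongr
    · exact hα.1.le
    · linarith

lemma cesaroNumber_neg_le (hα : α ∈ Ioo (0 : ℝ) 1) (n : ℕ) :
    cesaroNumber (-α) n ≤ ((n : ℝ) + 1) ^ (-α) := by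
  have hn : (0 : ℝ) < (n : ℝ) + 1 := by positivity
  rw [Real.rpow_neg hn.le, ← one_div, le_div_iff₀ (by positivity)]
  exact cesaroNumber_neg_mul_rpow_le hα n

/-- The right-hand side is `A_n^{1-α}` written through `A_n^{-α}`, which makes later quotients by
`A_n^{-α}` explicit. -/
lemma sum_cesaroNumber_neg (hα : α ∈ Ioo (0 : ℝ) 1) (n : ℕ) :
    ∑ i ∈ Finset.range (n + 1), cesaroNumber (-α) i
      = cesaroNumber (-α) n * ((n + 1 - α) / (1 - α)) := by
  have h1 : 1 - α ≠ 0 := by linarith [hα.2]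
  induction n with
  | zero => simp [h1]
  | succ n ih =>
    rw [Finset.sum_range_succ, ih, cesaroNumber_neg_succ]
    have : (n : ℝ) + 1 ≠ 0 := by positivity
    push_cast
    field_simp
    ring

lemma sum_cesaroNumber_neg_le (hα : α ∈ Ioo (0 : ℝ) 1) (n : ℕ) :
    ∑ i ∈ Finset.range n, cesaroNumber (-α) i ≤ (n : ℝ) ^ (1 - α) / (1 - α) := by
  have h1 : 0 < 1 - α := by linarith [hα.2]
  cases n with
  | zero => simp [Real.zero_rpow h1.ne']
  | succ n =>
    rw [sum_cesaroNumber_neg hα]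
    have hn : (0 : ℝ) < (n : ℝ) + 1 := by positivity
    have hA := cesaroNumber_neg_pos hα n
    calc cesaroNumber (-α) n * ((n + 1 - α) / (1 - α))
        ≤ ((n : ℝ) + 1) ^ (-α) * (((n : ℝ) + 1) / (1 - α)) := by
          gcongr
          · have := n.cast_nonneg (α := ℝ)
            exact div_nonneg (by linarith) h1.le
          · exact cesaroNumber_neg_le hα n
          · linarith [hα.1]
      _ = _ := by
          push_cast
          rw [sub_eq_add_neg, add_comm 1 (-α), Real.rpow_add hn, Real.rpow_one]
          ring

lemma cesaroNumber_neg_sub_succ_le (hα : α ∈ Ioo (0 : ℝ) 1) (n : ℕ) :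
    cesaroNumber (-α) n - cesaroNumber (-α) (n + 1) ≤ ((n : ℝ) + 1) ^ (-α) / ((n : ℝ) + 1) := by
  rw [cesaroNumber_neg_succ]
  have hA := cesaroNumber_neg_pos hα n
  have hn : (0 : ℝ) < (n : ℝ) + 1 := by positivity
  calc _ = cesaroNumber (-α) n * (α / (n + 1)) := by ring
    _ ≤ ((n : ℝ) + 1) ^ (-α) * (1 / (n + 1)) := by
      gcongr
      · exact div_nonneg hα.1.le hn.le
      · exact cesaroNumber_neg_le hα n
      · exact hα.2.le
    _ = _ := by ring

/-- Telescoping the increments over indices `≥ B - 1`. -/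
lemma cesaroNumber_neg_sub_le (hα : α ∈ Ioo (0 : ℝ) 1) {B n : ℕ} (hB : 0 < B) (hn : B ≤ n + 1)
    (d : ℕ) :
    cesaroNumber (-α) n - cesaroNumber (-α) (n + d) ≤ d * ((B : ℝ) ^ (-α) / B) := by
  induction d with
  | zero => simp
  | succ d ih =>
    have h := cesaroNumber_neg_sub_succ_le hα (n + d)
    have hB' : (0 : ℝ) < B := by exact_mod_cast hB
    have hBn : (B : ℝ) ≤ ((n + d : ℕ) : ℝ) + 1 := by exact_mod_cast (by omega : B ≤ n + d + 1)
    have h2 : (((n + d : ℕ) : ℝ) + 1) ^ (-α) / (((n + d : ℕ) : ℝ) + 1) ≤ (B : ℝ) ^ (-α) / B := by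
      gcongr ?_ / ?_
      exact Real.rpow_le_rpow_of_nonpos hB' hBn (by linarith [hα.1])
    rw [← add_assoc]
    push_cast at *
    linarith

end

/-! ### Walsh functions at dyadic rationals -/

/-- The sign attached to the `m`-th binary digit of `i`. -/
def bitSign (i m : ℕ) : ℝ := if i.testBit m then -1 else 1

lemma abs_bitSign (i m : ℕ) : |bitSign i m| = 1 := by
  unfold bitSign; split_ifs <;> simp

lemma bitSign_xor (i j m : ℕ) : bitSign (i ^^^ j) m = bitSign i m * bitSign j m := by
  unfold bitSign
  rw [Nat.testBit_xor]
  cases i.testBit m <;> cases j.testBit m <;> simp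

lemma r0_eq {y : ℝ} (hy : 0 ≤ y) : r0 y = bitSign ⌊2 * y⌋₊ 0 := by
  have h0 := Int.fract_nonneg y
  have h1 := Int.fract_lt_one y
  have hfl : (⌊y⌋₊ : ℝ) = y - Int.fract y := by
    rw [natCast_floor_eq_intCast_floor hy]; exact (Int.self_sub_fract y).symm
  unfold r0 bitSign
  split_ifs with h h' h'
  · exfalso
    have : ⌊2 * y⌋₊ = 2 * ⌊y⌋₊ := by
      rw [Nat.floor_eq_iff (by positivity)]; push_cast; constructor <;> linarith
    rw [this] at h'
    simp at h'
  · rfl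
  · rfl
  · exfalso
    have : ⌊2 * y⌋₊ = 2 * ⌊y⌋₊ + 1 := by
      rw [Nat.floor_eq_iff (by positivity)]; push_cast; constructor <;> linarith
    rw [this] at h'
    simp at h'

lemma floor_add_div_two_pow (i m : ℕ) {θ : ℝ} (hθ : θ ∈ I) :
    ⌊((i : ℝ) + θ) / 2 ^ m⌋₊ = i / 2 ^ m := by
  have h : ⌊(i : ℝ) + θ⌋₊ = i := by
    rw [Nat.floor_eq_iff (by have := hθ.1; positivity)]
    exact ⟨by linarith [hθ.1], by linarith [hθ.2]⟩
  have := Nat.floor_div_natCast ((i : ℝ) + θ) (2 ^ m)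
  push_cast at this
  rw [this, h]

/-- Binary digits of a point are read from the left and bits of its index from the right, hence the
reversal `R - 1 - t`. -/
lemma rademacher_grid {t R : ℕ} (ht : t < R) (i : ℕ) {θ : ℝ} (hθ : θ ∈ I) :
    rademacher t (((i : ℝ) + θ) / 2 ^ R) = bitSign i (R - 1 - t) := by
  have hθ0 := hθ.1
  unfold rademacher
  rw [r0_eq (by positivity)]
  have e : 2 * (2 ^ t * (((i : ℝ) + θ) / 2 ^ R)) = ((i : ℝ) + θ) / 2 ^ (R - 1 - t) := by
    have : (2 : ℝ) ^ R = 2 * 2 ^ t * 2 ^ (R - 1 - t) := by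
      rw [← pow_succ', ← pow_add]; congr 1; omega
    rw [this]; field_simp
  rw [e, floor_add_div_two_pow _ _ hθ]
  unfold bitSign
  rw [Nat.testBit_div_two_pow]
  simp

lemma walsh_eq_prod {k p : ℕ} (hk : k < 2 ^ p) (u : ℝ) :
    walsh k u = ∏ t ∈ Finset.range p, if k.testBit t then rademacher t u else 1 := by
  have h : k.bitIndices.toFinset = (Finset.range p).filter fun t => k.testBit t := by
    ext t
    simp only [List.mem_toFinset, Nat.mem_bitIndices, Finset.mem_filter, Finset.mem_range]
    refine ⟨fun ht => ⟨?_, ht⟩, fun ht => ht.2⟩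
    by_contra hlt
    have := Nat.testBit_lt_two_pow (hk.trans_le (Nat.pow_le_pow_right two_pos (not_lt.1 hlt)))
    simp [this] at ht
  rw [← Finset.prod_filter, ← h, List.prod_toFinset _ Nat.bitIndices_nodup]
  rfl

lemma walsh_grid {k R : ℕ} (hk : k < 2 ^ R) (i : ℕ) {θ : ℝ} (hθ : θ ∈ I) :
    walsh k (((i : ℝ) + θ) / 2 ^ R)
      = ∏ t ∈ Finset.range R, if k.testBit t then bitSign i (R - 1 - t) else 1 := by
  rw [walsh_eq_prod hk]
  refine Finset.prod_congr rfl fun t ht => ?_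
  rw [rademacher_grid (Finset.mem_range.1 ht) i hθ]

/-- The value of `w_k` on the `i`-th dyadic interval of length `2^{-R}`. -/
noncomputable def gridWalsh (R k i : ℕ) : ℝ := walsh k ((i : ℝ) / 2 ^ R)

lemma zero_mem_I : (0 : ℝ) ∈ I := ⟨le_rfl, one_pos⟩

lemma gridWalsh_eq_prod {k R : ℕ} (hk : k < 2 ^ R) (i : ℕ) :
    gridWalsh R k i = ∏ t ∈ Finset.range R, if k.testBit t then bitSign i (R - 1 - t) else 1 := by
  rw [← walsh_grid hk i zero_mem_I]; simp [gridWalsh]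

lemma walsh_eq_gridWalsh {k R : ℕ} (hk : k < 2 ^ R) (i : ℕ) {θ : ℝ} (hθ : θ ∈ I) :
    walsh k (((i : ℝ) + θ) / 2 ^ R) = gridWalsh R k i := by
  rw [walsh_grid hk i hθ, gridWalsh_eq_prod hk]

/-- Walsh functions are characters of the dyadic group; on grid indices its operation is xor. This
turns translation by `x` into xor with the index of `x`. -/
lemma gridWalsh_mul {k R : ℕ} (hk : k < 2 ^ R) (i j : ℕ) :
    gridWalsh R k i * gridWalsh R k j = gridWalsh R k (i ^^^ j) := by
  simp only [gridWalsh_eq_prod hk, ← Finset.prod_mul_distrib]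
  refine Finset.prod_congr rfl fun t _ => ?_
  split_ifs
  · rw [bitSign_xor]
  · simp

lemma abs_walsh (k : ℕ) (u : ℝ) : |walsh k u| = 1 := by
  rw [walsh_eq_prod k.lt_two_pow_self, Finset.abs_prod]
  refine Finset.prod_eq_one fun t _ => ?_
  unfold rademacher r0
  split_ifs <;> simp

lemma abs_gridWalsh (R k i : ℕ) : |gridWalsh R k i| = 1 := abs_walsh _ _

@[simp] lemma gridWalsh_zero (R i : ℕ) : gridWalsh R 0 i = 1 := by
  simp [gridWalsh, walsh]

lemma walsh_mul_two_pow_add (b l : ℕ) {k : ℕ} (hk : k < 2 ^ l) (u : ℝ) :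
    walsh (2 ^ l * b + k) u = walsh (2 ^ l * b) u * walsh k u := by
  have hp : 2 ^ l * b + k < 2 ^ (2 ^ l * b + k) := Nat.lt_two_pow_self
  rw [walsh_eq_prod hp, walsh_eq_prod (lt_of_le_of_lt (Nat.le_add_right _ _) hp),
    walsh_eq_prod (lt_of_le_of_lt (Nat.le_add_left k _) hp), ← Finset.prod_mul_distrib]
  refine Finset.prod_congr rfl fun t _ => ?_
  rw [Nat.testBit_two_pow_mul_add _ hk, Nat.testBit_two_pow_mul]
  by_cases ht : t < l
  · simp [ht, not_le.2 ht]
  · have : k.testBit t = false :=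
      Nat.testBit_lt_two_pow (hk.trans_le (Nat.pow_le_pow_right two_pos (not_lt.1 ht)))
    simp [ht, not_lt.1 ht, this]

lemma walsh_two_pow (l : ℕ) (u : ℝ) : walsh (2 ^ l) u = rademacher l u := by
  simp [walsh]

lemma sum_walsh_two_pow (l : ℕ) (u : ℝ) :
    ∑ k ∈ Finset.range (2 ^ l), walsh k u = ∏ t ∈ Finset.range l, (1 + rademacher t u) := by
  induction l with
  | zero => simp [walsh]
  | succ l ih =>
    rw [pow_succ, mul_two, Finset.sum_range_add, Finset.prod_range_succ, ← ih]
    have : ∀ k ∈ Finset.range (2 ^ l), walsh (2 ^ l + k) u = walsh k u * rademacher l u := by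
      intro k hk
      have := walsh_mul_two_pow_add 1 l (Finset.mem_range.1 hk) u
      rw [mul_one, walsh_two_pow] at this
      rw [this, mul_comm]
    rw [Finset.sum_congr rfl this, ← Finset.sum_mul]
    ring

/-- The Dirichlet kernel of order `2^l` is the product of the `1 + r_t`, `t < l`; an index beyond
the first `2^(R-l)` cells has a high bit set, which annihilates one factor. -/
lemma sum_gridWalsh_two_pow {l R i : ℕ} (hl : l ≤ R) (hi : 2 ^ (R - l) ≤ i) (hiR : i < 2 ^ R) :
    ∑ k ∈ Finset.range (2 ^ l), gridWalsh R k i = 0 := by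
  unfold gridWalsh
  rw [sum_walsh_two_pow]
  obtain ⟨m, hm, hb⟩ := Nat.exists_ge_and_testBit_of_ge_two_pow hi
  have hmR : m < R := by
    by_contra h
    have := Nat.testBit_lt_two_pow (hiR.trans_le (Nat.pow_le_pow_right two_pos (not_lt.1 h)))
    simp [this] at hb
  refine Finset.prod_eq_zero (i := R - 1 - m) (Finset.mem_range.2 (by omega)) ?_
  have := rademacher_grid (t := R - 1 - m) (R := R) (by omega) i zero_mem_I
  rw [add_zero] at this
  rw [this, show R - 1 - (R - 1 - m) = m by omega]
  simp [bitSign, hb]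

lemma gridWalsh_congr {k p R i j : ℕ} (hk : k < 2 ^ p) (hp : p ≤ R)
    (h : i / 2 ^ (R - p) = j / 2 ^ (R - p)) : gridWalsh R k i = gridWalsh R k j := by
  have hkR := hk.trans_le (Nat.pow_le_pow_right two_pos hp)
  rw [gridWalsh_eq_prod hkR, gridWalsh_eq_prod hkR]
  refine Finset.prod_congr rfl fun t ht => ?_
  by_cases htp : t < p
  · have : ∀ i : ℕ, bitSign i (R - 1 - t) = bitSign (i / 2 ^ (R - p)) (p - 1 - t) := by
      intro i
      unfold bitSign
      rw [Nat.testBit_div_two_pow, show p - 1 - t + (R - p) = R - 1 - t by omega]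
    rw [this i, this j, h]
  · have : k.testBit t = false :=
      Nat.testBit_lt_two_pow (hk.trans_le (Nat.pow_le_pow_right two_pos (not_lt.1 htp)))
    simp [this]

lemma sum_bitSign (m : ℕ) : ∑ s ∈ Finset.range (2 ^ (m + 1)), bitSign s m = 0 := by
  rw [pow_succ, mul_two, Finset.sum_range_add, ← Finset.sum_add_distrib]
  refine Finset.sum_eq_zero fun s hs => ?_
  unfold bitSign
  rw [Nat.testBit_two_pow_add_eq, Nat.testBit_lt_two_pow (Finset.mem_range.1 hs)]
  simp

lemma bitSign_mod (i : ℕ) (m : ℕ) : bitSign (i % 2 ^ (m + 1)) m = bitSign i m := by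
  unfold bitSign
  rw [Nat.testBit_mod_two_pow]
  simp

lemma gridWalsh_two_pow_add {k p R : ℕ} (hk : k < 2 ^ p) (hp : p < R) (i : ℕ) :
    gridWalsh R (2 ^ p + k) i = gridWalsh R k i * bitSign i (R - 1 - p) := by
  have h := walsh_mul_two_pow_add 1 p hk ((i : ℝ) / 2 ^ R)
  rw [mul_one, walsh_two_pow] at h
  have h2 := rademacher_grid hp i zero_mem_I
  rw [add_zero] at h2
  rw [gridWalsh, h, h2, mul_comm, gridWalsh]

/-- Primitives of Walsh functions. -/
lemma sum_range_gridWalsh {k p R : ℕ} (hk : k < 2 ^ p) (hp : p < R) (j : ℕ) :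
    ∑ i ∈ Finset.range j, gridWalsh R (2 ^ p + k) i
      = gridWalsh R k j * ∑ s ∈ Finset.range (j % 2 ^ (R - p)), bitSign s (R - 1 - p) := by
  have hR : R - p = (R - 1 - p) + 1 := by omega
  induction j with
  | zero => simp
  | succ j ih =>
    rw [Finset.sum_range_succ, ih, gridWalsh_two_pow_add hk hp, ← mul_add,
      ← bitSign_mod j, ← hR, ← Finset.sum_range_succ (fun s => bitSign s (R - 1 - p))]
    -- At the end of a dyadic block the inner sum has run over a full period and vanishes; inside a
    -- block the factor `w_k` does not change.
    by_cases h : (j + 1) % 2 ^ (R - p) = 0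
    · have hlt : j % 2 ^ (R - p) < 2 ^ (R - p) := Nat.mod_lt _ (by positivity)
      have : j % 2 ^ (R - p) + 1 = 2 ^ (R - p) := by
        have h1 := Nat.add_mod j 1 (2 ^ (R - p))
        rw [h] at h1
        by_contra hne
        have h2 : j % 2 ^ (R - p) + 1 < 2 ^ (R - p) := by omega
        rw [Nat.mod_eq_of_lt (a := 1) (by omega), Nat.mod_eq_of_lt h2] at h1
        omega
      rw [this, h, hR, sum_bitSign]
      simp
    · have h1 : (j + 1) / 2 ^ (R - p) = j / 2 ^ (R - p) := by
        rw [Nat.succ_div_of_not_dvd (fun hd => h (Nat.mod_eq_zero_of_dvd hd))]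
      have h2 : (j + 1) % 2 ^ (R - p) = j % 2 ^ (R - p) + 1 := by
        have e1 := Nat.div_add_mod (j + 1) (2 ^ (R - p))
        have e2 := Nat.div_add_mod j (2 ^ (R - p))
        rw [h1] at e1
        omega
      rw [h2, gridWalsh_congr hk hp.le h1]

lemma sum_range_two_pow_gridWalsh {k R : ℕ} (hk0 : k ≠ 0) (hk : k < 2 ^ R) :
    ∑ i ∈ Finset.range (2 ^ R), gridWalsh R k i = 0 := by
  obtain ⟨p, h1, h2⟩ : ∃ p, 2 ^ p ≤ k ∧ k < 2 ^ (p + 1) :=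
    ⟨Nat.log 2 k, Nat.pow_log_le_self 2 hk0, Nat.lt_pow_succ_log_self one_lt_two k⟩
  have hp : p < R := (Nat.pow_lt_pow_iff_right one_lt_two).1 (h1.trans_lt hk)
  obtain ⟨k', rfl⟩ := Nat.exists_eq_add_of_le h1
  rw [sum_range_gridWalsh (by rw [pow_succ] at h2; omega) hp,
    Nat.mod_eq_zero_of_dvd (pow_dvd_pow 2 (Nat.sub_le R p))]
  simp

/-! ### The Cesàro kernel of negative order -/

/-- On each block of length `2^l` the factor `w_{2^l q}` comes out and the remaining Walsh values
sum to zero, so the first coefficient of the block may be subtracted. Monotonicity then makes the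
block bounds telescope. -/
lemma abs_sum_monotone_gridWalsh_le {c : ℕ → ℝ} (hc : Monotone c) {l R i : ℕ}
    (h0 : ∑ k ∈ Finset.range (2 ^ l), gridWalsh R k i = 0) (q : ℕ) :
    |∑ k ∈ Finset.range (2 ^ l * q), c k * gridWalsh R k i| ≤ 2 ^ l * (c (2 ^ l * q) - c 0) := by
  induction q with
  | zero => simp
  | succ q ih =>
    rw [mul_add, mul_one, Finset.sum_range_add]
    have e : ∑ k ∈ Finset.range (2 ^ l), c (2 ^ l * q + k) * gridWalsh R (2 ^ l * q + k) i
        = gridWalsh R (2 ^ l * q) i *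
          ∑ k ∈ Finset.range (2 ^ l), (c (2 ^ l * q + k) - c (2 ^ l * q)) * gridWalsh R k i := by
      simp only [sub_mul, Finset.sum_sub_distrib, ← Finset.mul_sum, h0, mul_zero, sub_zero]
      rw [Finset.mul_sum]
      refine Finset.sum_congr rfl fun k hk => ?_
      rw [show gridWalsh R (2 ^ l * q + k) i = gridWalsh R (2 ^ l * q) i * gridWalsh R k i from
        walsh_mul_two_pow_add q l (Finset.mem_range.1 hk) _]
      ring
    have h2 : |∑ k ∈ Finset.range (2 ^ l),
        (c (2 ^ l * q + k) - c (2 ^ l * q)) * gridWalsh R k i|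
        ≤ 2 ^ l * (c (2 ^ l * q + 2 ^ l) - c (2 ^ l * q)) := by
      refine (Finset.abs_sum_le_sum_abs _ _).trans ?_
      refine (Finset.sum_le_card_nsmul _ _ (c (2 ^ l * q + 2 ^ l) - c (2 ^ l * q)) ?_).trans ?_
      · intro k hk
        have hk' := Finset.mem_range.1 hk
        rw [abs_mul, abs_gridWalsh, mul_one,
          abs_of_nonneg (sub_nonneg.2 (hc (Nat.le_add_right _ _)))]
        exact sub_le_sub_right (hc (by omega)) _
      · simp
    rw [e]
    refine (abs_add_le _ _).trans ?_
    rw [abs_mul, abs_gridWalsh, one_mul]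
    linarith

section
variable {α : ℝ}

lemma abs_sum_cesaroNumber_gridWalsh_le (hα : α ∈ Ioo (0 : ℝ) 1) {l R i : ℕ}
    (h0 : ∑ k ∈ Finset.range (2 ^ l), gridWalsh R k i = 0) {L N : ℕ} (hL : L ≤ N + 1) :
    |∑ k ∈ Finset.range L, cesaroNumber (-α) (N - k) * gridWalsh R k i|
      ≤ (1 + 2 / (1 - α)) * ((2 : ℝ) ^ l) ^ (1 - α) := by
  have h1α : 0 < 1 - α := by linarith [hα.2]
  have hmono := cesaroNumber_neg_antitone hα
  -- Whole blocks are kept only while the index `N - k` stays about `2^l` away from 0, where the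
  -- Cesàro numbers are largest. At most `2 * 2^l` terms remain, and these are bounded without
  -- cancellation.
  obtain ⟨q, hq⟩ : ∃ q, q = min L (N + 1 - 2 ^ l) / 2 ^ l := ⟨_, rfl⟩
  have hM : 0 < 2 ^ l := by positivity
  have hdm := Nat.div_add_mod (min L (N + 1 - 2 ^ l)) (2 ^ l)
  have hmod := Nat.mod_lt (min L (N + 1 - 2 ^ l)) hM
  rw [← hq] at hdm
  obtain ⟨T, hT⟩ : ∃ T, L = 2 ^ l * q + T := Nat.exists_eq_add_of_le (by omega)
  have hT2 : T ≤ 2 * 2 ^ l := by omega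
  rw [hT, Finset.sum_range_add]
  have hMr : (0 : ℝ) < (2 : ℝ) ^ l := by positivity
  have hfirst : |∑ k ∈ Finset.range (2 ^ l * q), cesaroNumber (-α) (N - k) * gridWalsh R k i|
      ≤ ((2 : ℝ) ^ l) ^ (1 - α) := by
    refine (abs_sum_monotone_gridWalsh_le (c := fun k => cesaroNumber (-α) (N - k))
      (fun a b hab => hmono (by omega)) h0 q).trans ?_
    rcases Nat.eq_zero_or_pos q with rfl | hqpos
    · simp; positivity
    have hge : 2 ^ l * 1 ≤ 2 ^ l * q := Nat.mul_le_mul_left _ hqpos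
    have hb : cesaroNumber (-α) (N - 2 ^ l * q) ≤ ((2 : ℝ) ^ l) ^ (-α) := by
      refine (cesaroNumber_neg_le hα _).trans ?_
      refine Real.rpow_le_rpow_of_nonpos hMr ?_ (by linarith [hα.1])
      exact_mod_cast (by omega : 2 ^ l ≤ N - 2 ^ l * q + 1)
    calc (2 : ℝ) ^ l * (cesaroNumber (-α) (N - 2 ^ l * q) - cesaroNumber (-α) (N - 0))
        ≤ (2 : ℝ) ^ l * ((2 : ℝ) ^ l) ^ (-α) := by
          gcongr
          linarith [cesaroNumber_neg_pos hα (N - 0)]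
      _ = ((2 : ℝ) ^ l) ^ (1 - α) := by
          rw [sub_eq_add_neg, Real.rpow_add hMr, Real.rpow_one]
  have hsecond : |∑ t ∈ Finset.range T,
      cesaroNumber (-α) (N - (2 ^ l * q + t)) * gridWalsh R (2 ^ l * q + t) i|
      ≤ 2 / (1 - α) * ((2 : ℝ) ^ l) ^ (1 - α) := by
    refine (Finset.abs_sum_le_sum_abs _ _).trans ?_
    calc _ ≤ ∑ t ∈ Finset.range T, cesaroNumber (-α) (T - 1 - t) := by
          refine Finset.sum_le_sum fun t ht => ?_
          have := Finset.mem_range.1 ht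
          rw [abs_mul, abs_gridWalsh, mul_one, abs_of_pos (cesaroNumber_neg_pos hα _)]
          exact hmono (by omega)
      _ = ∑ t ∈ Finset.range T, cesaroNumber (-α) t := Finset.sum_range_reflect _ _
      _ ≤ (T : ℝ) ^ (1 - α) / (1 - α) := sum_cesaroNumber_neg_le hα T
      _ ≤ (2 * (2 : ℝ) ^ l) ^ (1 - α) / (1 - α) := by
          gcongr
          exact_mod_cast hT2
      _ ≤ 2 * ((2 : ℝ) ^ l) ^ (1 - α) / (1 - α) := by
          rw [Real.mul_rpow two_pos.le hMr.le]
          gcongr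
          calc (2 : ℝ) ^ (1 - α) ≤ 2 ^ (1 : ℝ) :=
                Real.rpow_le_rpow_of_exponent_le one_le_two (by linarith [hα.1])
            _ = 2 := Real.rpow_one 2
      _ = _ := by ring
  calc _ ≤ _ := abs_add_le _ _
    _ ≤ _ := add_le_add hfirst hsecond
    _ = _ := by ring

/-- The integral of `w_k` over `[j 2^{-R}, 1)`. -/
noncomputable def walshTail (R k j : ℕ) : ℝ :=
  (∑ i ∈ Finset.Ico j (2 ^ R), gridWalsh R k i) / 2 ^ R

/-- A nonconstant Walsh function has mean zero, so its tail is minus its primitive. The second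
factor does not depend on `k`, so it can be taken out of a sum over a whole dyadic level. -/
lemma walshTail_two_pow_add {k p R j : ℕ} (hk : k < 2 ^ p) (hp : p < R) (hj : j ≤ 2 ^ R) :
    walshTail R (2 ^ p + k) j = gridWalsh R k j *
      -((∑ s ∈ Finset.range (j % 2 ^ (R - p)), bitSign s (R - 1 - p)) / 2 ^ R) := by
  have h0 : ∑ i ∈ Finset.range (2 ^ R), gridWalsh R (2 ^ p + k) i = 0 :=
    sum_range_two_pow_gridWalsh (by positivity) <| by
      have : 2 ^ (p + 1) ≤ 2 ^ R := Nat.pow_le_pow_right two_pos hp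
      rw [pow_succ] at this; omega
  have h := Finset.sum_range_add_sum_Ico (gridWalsh R (2 ^ p + k)) hj
  rw [h0, sum_range_gridWalsh hk hp] at h
  rw [walshTail, eq_neg_of_add_eq_zero_right h]
  ring

lemma abs_bitSign_sum_le {p R : ℕ} (hp : p < R) (j : ℕ) :
    |-((∑ s ∈ Finset.range (j % 2 ^ (R - p)), bitSign s (R - 1 - p)) / 2 ^ R)|
      ≤ ((2 : ℝ) ^ p)⁻¹ := by
  rw [abs_neg, abs_div, abs_of_pos (by positivity : (0 : ℝ) < 2 ^ R)]
  have h1 : |∑ s ∈ Finset.range (j % 2 ^ (R - p)), bitSign s (R - 1 - p)| ≤ 2 ^ (R - p) := by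
    refine (Finset.abs_sum_le_sum_abs _ _).trans ?_
    simp only [abs_bitSign, Finset.sum_const, Finset.card_range, nsmul_eq_mul, mul_one]
    exact_mod_cast (Nat.mod_lt j (by positivity)).le
  have h2 : (2 : ℝ) ^ R = 2 ^ (R - p) * 2 ^ p := by rw [← pow_add]; congr 1; omega
  rw [div_le_iff₀ (by positivity), h2]
  field_simp
  exact h1

lemma mul_abs_walshTail_le {k R j : ℕ} (hk : k < 2 ^ R) (hj : j ≤ 2 ^ R) :
    (k : ℝ) * |walshTail R k j| ≤ 2 := by
  rcases Nat.eq_zero_or_pos k with rfl | hk0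
  · simp
  obtain ⟨p, h1, h2⟩ : ∃ p, 2 ^ p ≤ k ∧ k < 2 ^ (p + 1) :=
    ⟨Nat.log 2 k, Nat.pow_log_le_self 2 hk0.ne', Nat.lt_pow_succ_log_self one_lt_two k⟩
  have hp : p < R := (Nat.pow_lt_pow_iff_right one_lt_two).1 (h1.trans_lt hk)
  obtain ⟨k', hk'⟩ := Nat.exists_eq_add_of_le h1
  have hw : |walshTail R k j| ≤ ((2 : ℝ) ^ p)⁻¹ := by
    rw [hk', walshTail_two_pow_add (by rw [pow_succ] at h2; omega) hp hj, abs_mul, abs_gridWalsh,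
      one_mul]
    exact abs_bitSign_sum_le hp j
  have hk2 : (k : ℝ) ≤ 2 ^ (p + 1) := by exact_mod_cast h2.le
  calc (k : ℝ) * |walshTail R k j| ≤ 2 ^ (p + 1) * ((2 : ℝ) ^ p)⁻¹ := by gcongr
    _ = 2 := by rw [pow_succ]; field_simp

lemma sum_walshTail_two_pow {l R j : ℕ} (hl : l ≤ R) (hj : 2 ^ (R - l) ≤ j) :
    ∑ k ∈ Finset.range (2 ^ l), walshTail R k j = 0 := by
  simp only [walshTail, ← Finset.sum_div]
  rw [Finset.sum_comm, Finset.sum_eq_zero, zero_div]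
  intro i hi
  rw [Finset.mem_Ico] at hi
  exact sum_gridWalsh_two_pow hl (hj.trans hi.1) hi.2

/-- The values of the normalized Cesàro kernel on the dyadic grid of mesh `2^{-R}`. -/
noncomputable def gridKernel (α : ℝ) (n R i : ℕ) : ℝ :=
  (∑ k ∈ Finset.range n,
    cesaroNumber (-α) (n - 1 - k) / cesaroNumber (-α) (n - 1) * gridWalsh R k i) / 2 ^ R

/-- The integral of the Cesàro kernel over `[j 2^{-R}, 1)`. -/
noncomputable def kernelTail (α : ℝ) (n R j : ℕ) : ℝ :=
  ∑ i ∈ Finset.Ico j (2 ^ R), gridKernel α n R i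

lemma kernelTail_eq (α : ℝ) (n R j : ℕ) :
    kernelTail α n R j = (∑ k ∈ Finset.range n, cesaroNumber (-α) (n - 1 - k) * walshTail R k j)
      / cesaroNumber (-α) (n - 1) := by
  simp only [kernelTail, gridKernel, walshTail, ← Finset.sum_div]
  rw [Finset.sum_comm, Finset.sum_div, Finset.sum_div]
  refine Finset.sum_congr rfl fun k _ => ?_
  rw [← Finset.mul_sum]
  ring

/-- Only `w_0` has nonzero mean, and its normalized coefficient is 1. -/
lemma sum_gridKernel (hα : α ∈ Ioo (0 : ℝ) 1) {n R : ℕ} (hn : 0 < n) (hnR : n ≤ 2 ^ R) :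
    ∑ i ∈ Finset.range (2 ^ R), gridKernel α n R i = 1 := by
  have h := kernelTail_eq α n R 0
  rw [kernelTail, ← Finset.range_eq_Ico] at h
  rw [h, Finset.sum_eq_single_of_mem 0 (Finset.mem_range.2 hn)]
  · have := (cesaroNumber_neg_pos hα (n - 1)).ne'
    simp [walshTail, this]
  · intro k hk hk0
    rw [walshTail, ← Finset.range_eq_Ico, sum_range_two_pow_gridWalsh hk0
      ((Finset.mem_range.1 hk).trans_le hnR)]
    simp

lemma abs_gridKernel_le (hα : α ∈ Ioo (0 : ℝ) 1) {n R : ℕ} (hn : 0 < n) (hnR : n ≤ 2 ^ R)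
    (i : ℕ) : |gridKernel α n R i| ≤ 1 / (1 - α) := by
  have h1α : 0 < 1 - α := by linarith [hα.2]
  have hA := cesaroNumber_neg_pos hα (n - 1)
  rw [gridKernel, abs_div, abs_of_pos (by positivity : (0 : ℝ) < 2 ^ R),
    div_le_iff₀ (by positivity)]
  refine (Finset.abs_sum_le_sum_abs _ _).trans ?_
  have e : ∑ k ∈ Finset.range n,
      |cesaroNumber (-α) (n - 1 - k) / cesaroNumber (-α) (n - 1) * gridWalsh R k i|
      = (∑ k ∈ Finset.range n, cesaroNumber (-α) k) / cesaroNumber (-α) (n - 1) := by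
    rw [← Finset.sum_range_reflect (cesaroNumber (-α)) n, Finset.sum_div]
    refine Finset.sum_congr rfl fun k _ => ?_
    rw [abs_mul, abs_gridWalsh, mul_one, abs_of_pos (div_pos (cesaroNumber_neg_pos hα _) hA)]
  obtain ⟨m, rfl⟩ := Nat.exists_eq_succ_of_ne_zero hn.ne'
  rw [e, Nat.succ_eq_add_one, sum_cesaroNumber_neg hα, Nat.add_sub_cancel, mul_div_right_comm,
    div_self (by simpa using hA.ne'), one_mul, div_mul_eq_mul_div]
  gcongr
  have : ((m + 1 : ℕ) : ℝ) ≤ 2 ^ R := by exact_mod_cast hnR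
  push_cast at this
  linarith [hα.1]

/-- Crude bound without cancellation, used for the few `j` too small for the decay argument. -/
lemma abs_kernelTail_le (hα : α ∈ Ioo (0 : ℝ) 1) {n R j : ℕ} (hn : 0 < n) (hnR : n ≤ 2 ^ R)
    (hj : j ≤ 2 ^ R) : |kernelTail α n R j| ≤ 1 + j * (1 / (1 - α)) := by
  have h := Finset.sum_range_add_sum_Ico (gridKernel α n R) hj
  rw [sum_gridKernel hα hn hnR] at h
  rw [kernelTail, eq_sub_of_add_eq' h]
  refine (abs_sub _ _).trans ?_
  rw [abs_one]
  gcongr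
  refine (Finset.abs_sum_le_sum_abs _ _).trans ?_
  refine (Finset.sum_le_card_nsmul _ _ _ fun i _ => abs_gridKernel_le hα hn hnR i).trans ?_
  simp

end

/-! ### Decay of the kernel tails -/

section
variable {α : ℝ}

lemma sum_range_two_pow_add_walshTail {p R j n L : ℕ} (hL : L ≤ 2 ^ p)
    (hp : p < R) (hj : j ≤ 2 ^ R) :
    |∑ k ∈ Finset.range L, cesaroNumber (-α) (n - 1 - (2 ^ p + k)) * walshTail R (2 ^ p + k) j|
      ≤ ((2 : ℝ) ^ p)⁻¹ *
        |∑ k ∈ Finset.range L, cesaroNumber (-α) (n - 1 - 2 ^ p - k) * gridWalsh R k j| := by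
  have e : ∀ k ∈ Finset.range L,
      cesaroNumber (-α) (n - 1 - (2 ^ p + k)) * walshTail R (2 ^ p + k) j
      = -((∑ s ∈ Finset.range (j % 2 ^ (R - p)), bitSign s (R - 1 - p)) / 2 ^ R) *
        (cesaroNumber (-α) (n - 1 - 2 ^ p - k) * gridWalsh R k j) := by
    intro k hk
    rw [walshTail_two_pow_add ((Finset.mem_range.1 hk).trans_le hL) hp hj, Nat.sub_add_eq]
    ring
  rw [Finset.sum_congr rfl e, ← Finset.mul_sum, abs_mul]
  gcongr
  exact abs_bitSign_sum_le hp j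

/-- The low-frequency part of the tail of the kernel. -/
lemma abs_sum_low_le (hα : α ∈ Ioo (0 : ℝ) 1) {r n l j : ℕ} (hn : 2 ^ (r + 1) ≤ n)
    (hj : 2 ^ (r + 2 - l) ≤ j) (hjR : j < 2 ^ (r + 2)) (d : ℕ) (hd : l + d ≤ r) :
    |∑ k ∈ Finset.range (2 ^ (l + d)), cesaroNumber (-α) (n - 1 - k) * walshTail (r + 2) k j|
      ≤ (2 + d) * (2 ^ l * (((2 : ℝ) ^ r) ^ (-α) / 2 ^ r)) := by
  have hB : 0 < 2 ^ r := by positivity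
  have hpow1 : 2 ^ (r + 1) = 2 * 2 ^ r := by rw [pow_succ]; ring
  have hpow2 : 2 ^ (r + 2) = 4 * 2 ^ r := by rw [pow_add]; ring
  induction d with
  -- Base case: the tails of `w_k`, `k < 2^l`, sum to zero, so `A_{n-1}` can be subtracted from each
  -- coefficient. The difference is at most `k` times an increment at scale `2^r`, and the factor
  -- `k` is absorbed by `k |walshTail| ≤ 2`.
  | zero =>
    have hl : 2 ^ l ≤ 2 ^ r := Nat.pow_le_pow_right two_pos (by omega)
    have h0 := sum_walshTail_two_pow (R := r + 2) (by omega : l ≤ r + 2) hj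
    have e : ∑ k ∈ Finset.range (2 ^ (l + 0)),
        cesaroNumber (-α) (n - 1 - k) * walshTail (r + 2) k j
        = ∑ k ∈ Finset.range (2 ^ l),
          (cesaroNumber (-α) (n - 1 - k) - cesaroNumber (-α) (n - 1)) * walshTail (r + 2) k j := by
      simp only [sub_mul, Finset.sum_sub_distrib, ← Finset.mul_sum, h0]
      simp
    rw [e]
    refine (Finset.abs_sum_le_sum_abs _ _).trans ?_
    refine (Finset.sum_le_card_nsmul _ _ (2 * (((2 : ℝ) ^ r) ^ (-α) / 2 ^ r)) ?_).trans
      (by simp; linarith)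
    intro k hk
    have hk' := Finset.mem_range.1 hk
    have hsub := cesaroNumber_neg_sub_le hα (B := 2 ^ r) (n := n - 1 - k) hB (by omega) k
    rw [show n - 1 - k + k = n - 1 by omega] at hsub
    have hnn : 0 ≤ cesaroNumber (-α) (n - 1 - k) - cesaroNumber (-α) (n - 1) :=
      sub_nonneg.2 (cesaroNumber_neg_antitone hα (by omega))
    rw [abs_mul, abs_of_nonneg hnn]
    push_cast at hsub
    calc _ ≤ (k : ℝ) * (((2 : ℝ) ^ r) ^ (-α) / 2 ^ r) * |walshTail (r + 2) k j| := by gcongr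
      _ = (k : ℝ) * |walshTail (r + 2) k j| * (((2 : ℝ) ^ r) ^ (-α) / 2 ^ r) := by ring
      _ ≤ _ := by
        gcongr
        exact mul_abs_walshTail_le (by omega) hjR.le
  | succ d ih =>
    rw [← add_assoc, pow_succ, mul_two, Finset.sum_range_add]
    have hp : 2 ^ (l + d) * 2 ≤ 2 ^ r := by
      rw [← pow_succ]; exact Nat.pow_le_pow_right two_pos (by omega)
    -- The primitive's factor `2^{-(l+d)}` cancels the length of the level in the variation of the
    -- coefficients, so each level costs one unit and the levels together give the factor `2 + d`.
    have hlev : |∑ k ∈ Finset.range (2 ^ (l + d)),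
        cesaroNumber (-α) (n - 1 - (2 ^ (l + d) + k)) * walshTail (r + 2) (2 ^ (l + d) + k) j|
        ≤ 2 ^ l * (((2 : ℝ) ^ r) ^ (-α) / 2 ^ r) := by
      refine (sum_range_two_pow_add_walshTail le_rfl (by omega) hjR.le).trans ?_
      have h0 := sum_gridWalsh_two_pow (R := r + 2) (by omega : l ≤ r + 2) hj hjR
      have hZ := abs_sum_monotone_gridWalsh_le
        (c := fun k => cesaroNumber (-α) (n - 1 - 2 ^ (l + d) - k))
        (fun a b hab => cesaroNumber_neg_antitone hα (by omega)) h0 (2 ^ d)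
      rw [← pow_add] at hZ
      have hsub := cesaroNumber_neg_sub_le hα (B := 2 ^ r)
        (n := n - 1 - 2 ^ (l + d) - 2 ^ (l + d)) hB (by omega) (2 ^ (l + d))
      rw [show n - 1 - 2 ^ (l + d) - 2 ^ (l + d) + 2 ^ (l + d) = n - 1 - 2 ^ (l + d) - 0 by omega]
        at hsub
      push_cast at hsub
      calc _ ≤ ((2 : ℝ) ^ (l + d))⁻¹ *
            (2 ^ l * (2 ^ (l + d) * (((2 : ℝ) ^ r) ^ (-α) / 2 ^ r))) := by
            gcongr
            refine hZ.trans ?_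
            gcongr
        _ = _ := by field_simp
    refine (abs_add_le _ _).trans ?_
    have := ih (by omega)
    push_cast
    linarith

/-- For `k < 2^r` the Cesàro index `n - 1 - k` is of order `2^r` and increments are small. On the
top two levels it may come down to 0, so the bound without increments is used there, with the gain
`2^{-r}` from the primitives. -/
lemma abs_sum_cesaroNumber_walshTail_le (hα : α ∈ Ioo (0 : ℝ) 1) {r n l j : ℕ}
    (hn : 2 ^ (r + 1) ≤ n) (hn2 : n < 2 ^ (r + 2)) (hl : l ≤ r)
    (hj : 2 ^ (r + 2 - l) ≤ j) (hjR : j < 2 ^ (r + 2)) :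
    |∑ k ∈ Finset.range n, cesaroNumber (-α) (n - 1 - k) * walshTail (r + 2) k j|
      ≤ (2 + (r - l : ℕ)) * (2 ^ l * (((2 : ℝ) ^ r) ^ (-α) / 2 ^ r))
        + 2 * (((2 : ℝ) ^ r)⁻¹ * ((1 + 2 / (1 - α)) * ((2 : ℝ) ^ l) ^ (1 - α))) := by
  have h1α : 0 < 1 - α := by linarith [hα.2]
  have hpow1 : 2 ^ (r + 1) = 2 ^ r + 2 ^ r := by rw [pow_succ]; ring
  have hpow2 : 2 ^ (r + 2) = 2 ^ (r + 1) + 2 ^ (r + 1) := by rw [pow_succ]; ring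
  have h0 := sum_gridWalsh_two_pow (R := r + 2) (by omega : l ≤ r + 2) hj hjR
  have hlow := abs_sum_low_le hα hn hj hjR (r - l) (by omega)
  rw [show l + (r - l) = r by omega] at hlow
  obtain ⟨m, hm⟩ := Nat.exists_eq_add_of_le hn
  have hlev : ∀ p L, p < r + 2 → r ≤ p → L ≤ 2 ^ p → L + 2 ^ p ≤ n →
      |∑ k ∈ Finset.range L, cesaroNumber (-α) (n - 1 - (2 ^ p + k)) *
        walshTail (r + 2) (2 ^ p + k) j|
      ≤ ((2 : ℝ) ^ r)⁻¹ * ((1 + 2 / (1 - α)) * ((2 : ℝ) ^ l) ^ (1 - α)) := by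
    intro p L hp hrp hLp hLn
    have hp0 : 0 < 2 ^ p := by positivity
    refine (sum_range_two_pow_add_walshTail hLp hp hjR.le).trans ?_
    gcongr
    · exact one_le_two
    · rcases Nat.eq_zero_or_pos L with rfl | hL0
      · simp; positivity
      · exact abs_sum_cesaroNumber_gridWalsh_le hα h0 (by omega)
  have ha := hlev r (2 ^ r) (by omega) le_rfl le_rfl (by omega)
  have hb := hlev (r + 1) m (by omega) (by omega) (by omega) (by omega)
  have hsplit : ∀ F : ℕ → ℝ, ∑ k ∈ Finset.range n, F k = ∑ k ∈ Finset.range (2 ^ r), F k +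
      ∑ k ∈ Finset.range (2 ^ r), F (2 ^ r + k) + ∑ k ∈ Finset.range m, F (2 ^ (r + 1) + k) := by
    intro F
    rw [hm, Finset.sum_range_add, hpow1, Finset.sum_range_add]
  rw [hsplit]
  refine (abs_add_three _ _ _).trans ?_
  linarith

/-- Absorbs the linear loss from counting levels: `d` is dominated by `2^{αd}`. -/
lemma exists_two_add_mul_le (hα : 0 < α) :
    ∃ K : ℝ, 0 < K ∧ ∀ d : ℕ, (2 + (d : ℝ)) * ((2 : ℝ) ^ d)⁻¹ ≤ K * ((2 : ℝ) ^ (α - 1)) ^ d := by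
  have hlog : 0 < α * Real.log 2 := mul_pos hα (Real.log_pos one_lt_two)
  refine ⟨2 + 1 / (α * Real.log 2), by positivity, fun d => ?_⟩
  have e : ((2 : ℝ) ^ (α - 1)) ^ d = ((2 : ℝ) ^ α) ^ d * ((2 : ℝ) ^ d)⁻¹ := by
    rw [Real.rpow_sub two_pos, Real.rpow_one, div_pow]; rfl
  rw [e, ← mul_assoc]
  gcongr
  have h1 : (d : ℝ) * (α * Real.log 2) ≤ ((2 : ℝ) ^ α) ^ d := by
    rw [Real.rpow_def_of_pos two_pos, ← Real.exp_nat_mul]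
    have := Real.add_one_le_exp ((d : ℝ) * (Real.log 2 * α))
    linarith
  have h2 : 1 ≤ ((2 : ℝ) ^ α) ^ d := one_le_pow₀ (Real.one_le_rpow one_le_two hα.le)
  have h3 : (d : ℝ) ≤ 1 / (α * Real.log 2) * ((2 : ℝ) ^ α) ^ d := by
    rw [one_div_mul_eq_div, le_div_iff₀ hlog]; exact h1
  nlinarith

/-- The decay of the tails of the Cesàro kernel of negative order. -/
theorem exists_abs_kernelTail_le (hα : α ∈ Ioo (0 : ℝ) 1) :
    ∃ C : ℝ, 0 < C ∧ ∀ r n j : ℕ, 2 ^ (r + 1) ≤ n → n < 2 ^ (r + 2) → j < 2 ^ (r + 2) →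
      |kernelTail α n (r + 2) j| ≤ C * ((2 : ℝ) ^ (α - 1)) ^ j.size := by
  have h1α : 0 < 1 - α := by linarith [hα.2]
  obtain ⟨K, hK, hKd⟩ := exists_two_add_mul_le hα.1
  set ρ : ℝ := (2 : ℝ) ^ (α - 1) with hρ
  have hρ0 : 0 < ρ := by positivity
  have hρ1 : ρ ≤ 1 := Real.rpow_le_one_of_one_le_of_nonpos one_le_two (by linarith)
  have hρ2 : 1 / 2 ≤ ρ := by
    calc (1 / 2 : ℝ) = 2 ^ (-1 : ℝ) := by rw [Real.rpow_neg_one]; norm_num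
      _ ≤ ρ := Real.rpow_le_rpow_of_exponent_le one_le_two (by linarith [hα.1])
  set C1 : ℝ := 4 / (1 - α) * (K + 2 * (1 + 2 / (1 - α))) with hC1
  have hC1pos : 0 < C1 := by positivity
  set C2 : ℝ := 1 + 4 * (1 / (1 - α)) with hC2
  have hC2pos : 0 < C2 := by positivity
  -- Since `ρ ≥ 1/2`, the factor 4 pays for sizes at most 2, and 8 for replacing `ρ^(size - 3)` by
  -- `ρ^size`.
  refine ⟨8 * C1 + 4 * C2, by positivity, fun r n j hn hn2 hj => ?_⟩
  have hn0 : 0 < n := lt_of_lt_of_le (by positivity) hn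
  by_cases hs : j.size ≤ 2
  · have hj4 : j < 4 := by simpa using Nat.size_le.1 hs
    refine (abs_kernelTail_le hα hn0 hn2.le hj.le).trans ?_
    have hj4' : (j : ℝ) ≤ 4 := by exact_mod_cast hj4.le
    have h2 : 1 / 4 ≤ ρ ^ j.size := by
      calc (1 / 4 : ℝ) = (1 / 2) ^ 2 := by norm_num
        _ ≤ ρ ^ 2 := by gcongr
        _ ≤ ρ ^ j.size := pow_le_pow_of_le_one hρ0.le hρ1 hs
    calc 1 + j * (1 / (1 - α)) ≤ C2 := by rw [hC2]; gcongr
      _ = 4 * C2 * (1 / 4) := by ring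
      _ ≤ 4 * C2 * ρ ^ j.size := by gcongr
      _ ≤ _ := by gcongr; linarith
  · have hsR : j.size ≤ r + 2 := Nat.size_le.2 hj
    -- With `l = r - d` the point `j 2^{-(r+2)}` lies beyond `2^{-l}`, where the Dirichlet kernel of
    -- order `2^l` vanishes.
    obtain ⟨d, hd⟩ : ∃ d, j.size = d + 3 := ⟨j.size - 3, by omega⟩
    have hdr : d + 1 ≤ r := by omega
    obtain ⟨l, hl⟩ : ∃ l, r = l + d := ⟨r - d, by omega⟩
    have hjlow : 2 ^ (r + 2 - l) ≤ j := by
      rw [show r + 2 - l = d + 2 by omega]; exact Nat.lt_size.1 (by omega)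
    have hA := cesaroNumber_neg_pos hα (n - 1)
    have hmain := abs_sum_cesaroNumber_walshTail_le hα hn hn2 (by omega : l ≤ r) hjlow hj
    have hB : (0 : ℝ) < (2 : ℝ) ^ r := by positivity
    -- The normalizing number is of order at least `2^{-rα}`, matching the factor gained in `hX`.
    have hAlow : (1 - α) / 4 ≤ cesaroNumber (-α) (n - 1) * ((2 : ℝ) ^ r) ^ α := by
      have h := le_cesaroNumber_neg_mul_rpow hα (n - 1)
      have e : ((n - 1 : ℕ) : ℝ) + 1 = n := by exact_mod_cast (by omega : n - 1 + 1 = n)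
      rw [e] at h
      have h4 : (n : ℝ) ^ α ≤ 4 * ((2 : ℝ) ^ r) ^ α := by
        calc (n : ℝ) ^ α ≤ (4 * (2 : ℝ) ^ r) ^ α := by
              gcongr
              · exact hα.1.le
              · calc (n : ℝ) ≤ 2 ^ (r + 2) := by exact_mod_cast hn2.le
                  _ = _ := by rw [pow_add]; ring
          _ = (4 : ℝ) ^ α * ((2 : ℝ) ^ r) ^ α := Real.mul_rpow (by norm_num) hB.le
          _ ≤ (4 : ℝ) ^ (1 : ℝ) * ((2 : ℝ) ^ r) ^ α := by
              gcongr
              · norm_num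
              · exact hα.2.le
          _ = _ := by rw [Real.rpow_one]
      have h5 : cesaroNumber (-α) (n - 1) * (n : ℝ) ^ α
          ≤ cesaroNumber (-α) (n - 1) * (4 * ((2 : ℝ) ^ r) ^ α) := by gcongr
      linarith
    have hX : (2 + ((r - l : ℕ) : ℝ)) * (2 ^ l * (((2 : ℝ) ^ r) ^ (-α) / 2 ^ r))
        + 2 * (((2 : ℝ) ^ r)⁻¹ * ((1 + 2 / (1 - α)) * ((2 : ℝ) ^ l) ^ (1 - α)))
        ≤ (K + 2 * (1 + 2 / (1 - α))) * ρ ^ d * (((2 : ℝ) ^ r) ^ α)⁻¹ := by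
      have hrl : r - l = d := by omega
      have e1 : (2 : ℝ) ^ l * (((2 : ℝ) ^ r) ^ (-α) / 2 ^ r)
          = ((2 : ℝ) ^ d)⁻¹ * (((2 : ℝ) ^ r) ^ α)⁻¹ := by
        rw [Real.rpow_neg hB.le, hl, pow_add]; field_simp
      have e2 : ((2 : ℝ) ^ r)⁻¹ * ((2 : ℝ) ^ l) ^ (1 - α) = ρ ^ d * (((2 : ℝ) ^ r) ^ α)⁻¹ := by
        have e3 : ρ ^ d = ((2 : ℝ) ^ d) ^ α / 2 ^ d := by
          rw [hρ, Real.rpow_sub two_pos, Real.rpow_one, div_pow, ← Real.rpow_natCast,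
            ← Real.rpow_natCast, ← Real.rpow_mul two_pos.le, ← Real.rpow_mul two_pos.le,
            mul_comm]
        have e4 : ((2 : ℝ) ^ l) ^ (1 - α) = 2 ^ l / ((2 : ℝ) ^ l) ^ α := by
          rw [Real.rpow_sub (by positivity), Real.rpow_one]
        have e5 : ((2 : ℝ) ^ r) ^ α = ((2 : ℝ) ^ l) ^ α * ((2 : ℝ) ^ d) ^ α := by
          rw [hl, pow_add, Real.mul_rpow (by positivity) (by positivity)]
        rw [e3, e4, e5, hl, pow_add]
        have : ((2 : ℝ) ^ d) ^ α ≠ 0 := by positivity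
        have : ((2 : ℝ) ^ l) ^ α ≠ 0 := by positivity
        field_simp
      rw [hrl, e1]
      calc _ = (2 + (d : ℝ)) * ((2 : ℝ) ^ d)⁻¹ * (((2 : ℝ) ^ r) ^ α)⁻¹ +
            2 * (1 + 2 / (1 - α)) * (((2 : ℝ) ^ r)⁻¹ * ((2 : ℝ) ^ l) ^ (1 - α)) := by ring
        _ ≤ K * ρ ^ d * (((2 : ℝ) ^ r) ^ α)⁻¹ +
            2 * (1 + 2 / (1 - α)) * (ρ ^ d * (((2 : ℝ) ^ r) ^ α)⁻¹) := by
            rw [e2]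
            exact add_le_add_left (mul_le_mul_of_nonneg_right (hKd d) (by positivity)) _
        _ = _ := by ring
    have hQ : |kernelTail α n (r + 2) j| ≤ C1 * ρ ^ d := by
      rw [kernelTail_eq, abs_div, abs_of_pos hA, div_le_iff₀ hA]
      refine (hmain.trans hX).trans ?_
      have hBα : 0 < ((2 : ℝ) ^ r) ^ α := by positivity
      rw [← div_eq_mul_inv, div_le_iff₀ hBα]
      calc (K + 2 * (1 + 2 / (1 - α))) * ρ ^ d = C1 * ρ ^ d * ((1 - α) / 4) := by
            rw [hC1]; field_simp
        _ ≤ C1 * ρ ^ d * (cesaroNumber (-α) (n - 1) * ((2 : ℝ) ^ r) ^ α) := by gcongr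
        _ = _ := by ring
    refine hQ.trans ?_
    have h8 : 1 / 8 ≤ ρ ^ 3 := by
      calc (1 / 8 : ℝ) = (1 / 2) ^ 3 := by norm_num
        _ ≤ ρ ^ 3 := by gcongr
    rw [hd]
    calc C1 * ρ ^ d = 8 * C1 * (ρ ^ d * (1 / 8)) := by ring
      _ ≤ 8 * C1 * (ρ ^ d * ρ ^ 3) := by gcongr
      _ = 8 * C1 * ρ ^ (d + 3) := by rw [pow_add]
      _ ≤ _ := by gcongr; linarith

end

/-! ### Summation by parts -/

/-- Backward differences, with the convention `g (-1) = 0`. -/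
def backDiff (g : ℕ → ℝ) (i : ℕ) : ℝ := g i - if i = 0 then 0 else g (i - 1)

lemma sum_range_backDiff (g : ℕ → ℝ) (i : ℕ) :
    ∑ k ∈ Finset.range (i + 1), backDiff g k = g i := by
  induction i with
  | zero => simp [backDiff]
  | succ i ih => rw [Finset.sum_range_succ, ih]; simp [backDiff]

/-- Abel summation; the convention at index 0 absorbs the boundary term. -/
lemma sum_mul_eq_sum_backDiff_mul (g k : ℕ → ℝ) (n : ℕ) :
    ∑ i ∈ Finset.range n, g i * k i
      = ∑ i ∈ Finset.range n, backDiff g i * ∑ i' ∈ Finset.Ico i n, k i' := by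
  simp only [Finset.mul_sum, Finset.range_eq_Ico]
  rw [Finset.sum_Ico_Ico_comm]
  refine Finset.sum_congr rfl fun i _ => ?_
  rw [← Finset.sum_mul, ← Finset.range_eq_Ico, sum_range_backDiff]

/-- Mixed second differences. -/
def mixedDiff (g : ℕ → ℕ → ℝ) (i j : ℕ) : ℝ := backDiff (fun i => backDiff (g i) j) i

lemma mixedDiff_swap (g : ℕ → ℕ → ℝ) (i j : ℕ) :
    mixedDiff (fun a b => g b a) j i = mixedDiff g i j := by
  unfold mixedDiff backDiff
  by_cases hi : i = 0 <;> by_cases hj : j = 0 <;> simp [hi, hj]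
  ring

lemma sum_sum_mul_eq (g : ℕ → ℕ → ℝ) (k k' : ℕ → ℝ) (M N : ℕ) :
    ∑ i ∈ Finset.range M, ∑ j ∈ Finset.range N, g i j * (k i * k' j)
      = ∑ i ∈ Finset.range M, ∑ j ∈ Finset.range N, mixedDiff g i j *
          ((∑ i' ∈ Finset.Ico i M, k i') * ∑ j' ∈ Finset.Ico j N, k' j') := by
  have h1 : ∀ i, ∑ j ∈ Finset.range N, g i j * (k i * k' j)
      = ∑ j ∈ Finset.range N, (backDiff (g i) j * ∑ j' ∈ Finset.Ico j N, k' j') * k i := by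
    intro i
    rw [← Finset.sum_mul, ← sum_mul_eq_sum_backDiff_mul, Finset.sum_mul]
    exact Finset.sum_congr rfl fun _ _ => by ring
  simp only [h1]
  rw [Finset.sum_comm]
  conv_rhs => rw [Finset.sum_comm]
  refine Finset.sum_congr rfl fun j _ => ?_
  have := sum_mul_eq_sum_backDiff_mul (fun i => backDiff (g i) j) k M
  calc _ = (∑ i ∈ Finset.range M, backDiff (g i) j * k i) * ∑ j' ∈ Finset.Ico j N, k' j' := by
        rw [Finset.sum_mul]; exact Finset.sum_congr rfl fun _ _ => by ring
    _ = _ := by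
        rw [this, Finset.sum_mul]
        exact Finset.sum_congr rfl fun _ _ => by rw [mixedDiff]; ring

/-! ### Moduli of variation along the dyadic grid -/

lemma vSharp2_eq (f : ℝ → ℝ → ℝ) (n : ℕ) : vSharp2 f n = vSharp1 (fun s t => f t s) n := rfl

/-- Dyadic translation may reverse a pair `s q`, `s' q`, so disjointness is expressed through
enclosing intervals `[lo q, hi q]`. -/
lemma sum_abs_sub_le_vSharp1 {f : ℝ → ℝ → ℝ} {n : ℕ} (hfin : vSharp1 f n ≠ ∞)
    {s s' lo hi : Fin n → ℝ} (hs : ∀ q, s q ∈ I) (hs' : ∀ q, s' q ∈ I) (hne : ∀ q, s q ≠ s' q)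
    (hlo : ∀ q, lo q ≤ s q ∧ lo q ≤ s' q) (hhi : ∀ q, s q ≤ hi q ∧ s' q ≤ hi q)
    (hsep : ∀ q q', q ≠ q' → hi q ≤ lo q' ∨ hi q' ≤ lo q) {y : ℝ} (hy : y ∈ I) :
    ∑ q, |f (s q) y - f (s' q) y| ≤ (vSharp1 f n).toReal := by
  have hN : Nonoverlapping (fun q => min (s q) (s' q)) (fun q => max (s q) (s' q)) := by
    refine ⟨fun q => ⟨?_, ?_, min_lt_max.2 (hne q)⟩, fun q q' hqq => ?_⟩
    · rcases min_choice (s q) (s' q) with h | h <;> simp only [h, hs, hs']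
    · rcases max_choice (s q) (s' q) with h | h <;> simp only [h, hs, hs']
    · change Disjoint (Ioo _ _) (Ioo _ _)
      rw [Set.disjoint_left]
      rintro t ⟨h1, h2⟩ ⟨h3, h4⟩
      have a1 := le_min (hlo q).1 (hlo q).2
      have a2 := max_le (hhi q).1 (hhi q).2
      have a3 := le_min (hlo q').1 (hlo q').2
      have a4 := max_le (hhi q').1 (hhi q').2
      rcases hsep q q' hqq with h | h
      · linarith
      · linarith
  have hle : ∑ q, ENNReal.ofReal |f (max (s q) (s' q)) y - f (min (s q) (s' q)) y|
      ≤ vSharp1 f n := by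
    unfold vSharp1
    exact le_iSup_of_le (fun _ => y) (le_iSup_of_le (fun _ => hy) (le_iSup_of_le _
      (le_iSup_of_le _ (le_iSup_of_le hN le_rfl))))
  rw [← ENNReal.ofReal_sum_of_nonneg (fun _ _ => abs_nonneg _)] at hle
  have h := (ENNReal.ofReal_le_iff_le_toReal hfin).1 hle
  refine le_trans (le_of_eq (Finset.sum_congr rfl fun q _ => ?_)) h
  rcases le_total (s q) (s' q) with h | h
  · rw [max_eq_right h, min_eq_left h, abs_sub_comm]
  · rw [max_eq_left h, min_eq_right h]

/-- Cut the interval at its midpoint. The hypothesis starts at `2^1`, while the first dyadic level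
needs `2^0`. -/
lemma vSharp1_one_le_two (f : ℝ → ℝ → ℝ) : vSharp1 f 1 ≤ vSharp1 f 2 := by
  conv_lhs => unfold vSharp1
  refine iSup_le fun y => iSup_le fun hy => iSup_le fun a => iSup_le fun b => iSup_le fun hN => ?_
  obtain ⟨⟨ha0, ha1⟩, ⟨hb0, hb1⟩, hab⟩ := hN.1 0
  set c := (a 0 + b 0) / 2 with hc
  have hac : a 0 < c := by linarith
  have hcb : c < b 0 := by linarith
  have hN2 : Nonoverlapping ![a 0, c] ![c, b 0] := by
    refine ⟨fun i => ?_, fun i j hij => ?_⟩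
    · fin_cases i
      · exact ⟨⟨ha0, ha1⟩, ⟨by simp; linarith, by simp; linarith⟩, by simpa using hac⟩
      · exact ⟨⟨by simp; linarith, by simp; linarith⟩, ⟨hb0, hb1⟩, by simpa using hcb⟩
    · fin_cases i <;> fin_cases j <;> simp at hij ⊢
  have hle : ∑ i : Fin 2, ENNReal.ofReal |f (![c, b 0] i) (y 0) - f (![a 0, c] i) (y 0)|
      ≤ vSharp1 f 2 := by
    unfold vSharp1
    exact le_iSup_of_le (fun _ => y 0) (le_iSup_of_le (fun _ => hy 0) (le_iSup_of_le _
      (le_iSup_of_le _ (le_iSup_of_le hN2 le_rfl))))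
  refine le_trans ?_ hle
  simp only [Fin.sum_univ_two, Fin.sum_univ_one, Matrix.cons_val_zero, Matrix.cons_val_one]
  rw [← ENNReal.ofReal_add (abs_nonneg _) (abs_nonneg _)]
  refine ENNReal.ofReal_le_ofReal ?_
  have := abs_add_le (f c (y 0) - f (a 0) (y 0)) (f (b 0) (y 0) - f c (y 0))
  calc _ = |f c (y 0) - f (a 0) (y 0) + (f (b 0) (y 0) - f c (y 0))| := by congr 1; simp
    _ ≤ _ := this

lemma abs_sub_le_vSharp1_one {f : ℝ → ℝ → ℝ} (hfin : vSharp1 f 1 ≠ ∞) {s s' y : ℝ} (hs : s ∈ I)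
    (hs' : s' ∈ I) (hy : y ∈ I) : |f s y - f s' y| ≤ (vSharp1 f 1).toReal := by
  by_cases h : s = s'
  · simp [h]
  · have := sum_abs_sub_le_vSharp1 hfin (s := fun _ => s) (s' := fun _ => s') (lo := fun _ => 0)
      (hi := fun _ => 1) (fun _ => hs) (fun _ => hs') (fun _ => h) (fun _ => ⟨hs.1, hs'.1⟩)
      (fun _ => ⟨hs.2.le, hs'.2.le⟩) (fun q q' hq => (hq (Subsingleton.elim _ _)).elim) hy
    simpa using this

/-- The points of the dyadic grid of mesh `2^{-R}` with offset `θ 2^{-R}`. -/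
noncomputable def gridPoint (R : ℕ) (θ : ℝ) (i : ℕ) : ℝ := ((i : ℝ) + θ) / 2 ^ R

lemma gridPoint_mem_I {R i : ℕ} {θ : ℝ} (hθ : θ ∈ I) (hi : i < 2 ^ R) : gridPoint R θ i ∈ I := by
  have hi' : (i : ℝ) + 1 ≤ 2 ^ R := by exact_mod_cast hi
  constructor
  · have := hθ.1
    unfold gridPoint
    positivity
  · rw [gridPoint, div_lt_one (by positivity)]
    linarith [hθ.2]

lemma gridPoint_bounds {R m B a : ℕ} {θ : ℝ} (hθ : θ ∈ I) (h : a / 2 ^ m = B) :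
    ((B * 2 ^ m : ℕ) : ℝ) / 2 ^ R ≤ gridPoint R θ a ∧
      gridPoint R θ a ≤ (((B + 1) * 2 ^ m : ℕ) : ℝ) / 2 ^ R := by
  have h1 : B * 2 ^ m ≤ a := by rw [← h]; exact Nat.div_mul_le_self _ _
  have h2 : a + 1 ≤ (B + 1) * 2 ^ m := by
    exact (Nat.div_lt_iff_lt_mul (by positivity)).1 (by omega)
  have h1' : ((B * 2 ^ m : ℕ) : ℝ) ≤ a := by exact_mod_cast h1
  have h2' : (a : ℝ) + 1 ≤ (((B + 1) * 2 ^ m : ℕ) : ℝ) := by exact_mod_cast h2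
  unfold gridPoint
  constructor
  · gcongr; linarith [hθ.1]
  · gcongr; linarith [hθ.2]

/-- The index `2^k (2q+1)` and its predecessor share the `q`-th dyadic block of length `2^(k+1)`.
Xor with `ξ` permutes these blocks, so distinct `q` still give nonoverlapping intervals. Intervals
from different `k` may overlap after translation, which is why levels are treated separately. -/
lemma sum_level_le {f : ℝ → ℝ → ℝ} {R k p ξ : ℕ} (hfin : vSharp1 f (2 ^ p) ≠ ∞)
    (hpk : p + k + 1 ≤ R) (hξ : ξ < 2 ^ R) {θ y : ℝ} (hθ : θ ∈ I) (hy : y ∈ I) :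
    ∑ q ∈ Finset.range (2 ^ p), |f (gridPoint R θ ((2 ^ k * (2 * q + 1)) ^^^ ξ)) y -
      f (gridPoint R θ ((2 ^ k * (2 * q + 1) - 1) ^^^ ξ)) y| ≤ (vSharp1 f (2 ^ p)).toReal := by
  rw [Finset.sum_range]
  have hk : 0 < 2 ^ k := by positivity
  have hdiv : ∀ q : ℕ, 2 ^ k * (2 * q + 1) / 2 ^ (k + 1) = q ∧
      (2 ^ k * (2 * q + 1) - 1) / 2 ^ (k + 1) = q := by
    intro q
    have e : 2 ^ k * (2 * q + 1) = 2 ^ (k + 1) * q + 2 ^ k := by rw [pow_succ]; ring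
    have e2 : 2 ^ (k + 1) = 2 * 2 ^ k := by rw [pow_succ]; ring
    rw [e]
    constructor
    · rw [Nat.mul_add_div (by positivity), Nat.div_eq_of_lt (by omega), add_zero]
    · rw [Nat.add_sub_assoc hk, Nat.mul_add_div (by positivity), Nat.div_eq_of_lt (by omega),
        add_zero]
  have hlt : ∀ q : Fin (2 ^ p), 2 ^ k * (2 * (q : ℕ) + 1) < 2 ^ R := by
    intro q
    have : 2 ^ (k + 1) * ((q : ℕ) + 1) ≤ 2 ^ (k + 1) * 2 ^ p := Nat.mul_le_mul_left _ q.2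
    have h2 : 2 ^ (k + 1) * 2 ^ p ≤ 2 ^ R := by
      rw [← pow_add]; exact Nat.pow_le_pow_right two_pos (by omega)
    rw [pow_succ] at *
    nlinarith
  have hx : ∀ i : ℕ, (i ^^^ ξ) / 2 ^ (k + 1) = (i / 2 ^ (k + 1)) ^^^ (ξ / 2 ^ (k + 1)) := by
    intro i
    exact Nat.xor_div_two_pow
  have hb1 : ∀ q : Fin (2 ^ p), _ := fun q => gridPoint_bounds (R := R) hθ
    ((hx (2 ^ k * (2 * (q : ℕ) + 1))).trans (by rw [(hdiv q).1]))
  have hb2 : ∀ q : Fin (2 ^ p), _ := fun q => gridPoint_bounds (R := R) hθ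
    ((hx (2 ^ k * (2 * (q : ℕ) + 1) - 1)).trans (by rw [(hdiv q).2]))
  refine sum_abs_sub_le_vSharp1 hfin
    (s := fun q : Fin (2 ^ p) => gridPoint R θ ((2 ^ k * (2 * (q : ℕ) + 1)) ^^^ ξ))
    (s' := fun q : Fin (2 ^ p) => gridPoint R θ ((2 ^ k * (2 * (q : ℕ) + 1) - 1) ^^^ ξ))
    (fun q => gridPoint_mem_I hθ (Nat.xor_lt_two_pow (hlt q) hξ))
    (fun q => gridPoint_mem_I hθ (Nat.xor_lt_two_pow ((Nat.sub_le _ _).trans_lt (hlt q)) hξ))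
    (fun q => ?_) (fun q => ⟨(hb1 q).1, (hb2 q).1⟩) (fun q => ⟨(hb1 q).2, (hb2 q).2⟩) ?_ hy
  · intro h
    unfold gridPoint at h
    rw [div_left_inj' (by positivity), add_left_inj, Nat.cast_inj, Nat.xor_left_inj] at h
    have : 0 < 2 ^ k * (2 * (q : ℕ) + 1) := by positivity
    omega
  · intro q q' hq
    have hne : (q : ℕ) ^^^ (ξ / 2 ^ (k + 1)) ≠ (q' : ℕ) ^^^ (ξ / 2 ^ (k + 1)) := by
      rw [Ne, Nat.xor_left_inj]
      exact fun h => hq (Fin.ext h)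
    rcases lt_or_gt_of_ne hne with h | h
    · left; gcongr; exact h
    · right; gcongr; exact h

/-- Sorts the positive integers below `2^a` by their 2-adic valuation `k`. -/
lemma sum_Ico_one_two_pow (a : ℕ) (h : ℕ → ℝ) :
    ∑ i ∈ Finset.Ico 1 (2 ^ a), h i
      = ∑ k ∈ Finset.range a, ∑ q ∈ Finset.range (2 ^ (a - 1 - k)), h (2 ^ k * (2 * q + 1)) := by
  induction a generalizing h with
  | zero => simp
  | succ a ih =>
    have hodd : ∀ n : ℕ, ∑ i ∈ Finset.Ico 1 (2 * (n + 1)), h i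
        = ∑ q ∈ Finset.range (n + 1), h (2 * q + 1) + ∑ i ∈ Finset.Ico 1 (n + 1), h (2 * i) := by
      intro n
      induction n with
      | zero => simp
      | succ n ihn =>
        rw [show 2 * (n + 1 + 1) = 2 * (n + 1) + 1 + 1 by ring,
          Finset.sum_Ico_succ_top (by omega), Finset.sum_Ico_succ_top (by omega), ihn,
          Finset.sum_range_succ _ (n + 1), Finset.sum_Ico_succ_top (b := n + 1) (by omega)]
        ring
    obtain ⟨n, hn⟩ := Nat.exists_eq_succ_of_ne_zero (pow_pos two_pos a : 0 < 2 ^ a).ne'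
    have := hodd n
    rw [← Nat.succ_eq_add_one, ← hn, ← pow_succ'] at this
    rw [this, ih, Finset.sum_range_succ']
    rw [add_comm]
    congr 1
    · refine Finset.sum_congr rfl fun k _ => ?_
      rw [show a + 1 - 1 - (k + 1) = a - 1 - k by omega]
      refine Finset.sum_congr rfl fun q _ => ?_
      congr 1; ring
    · simp

/-- The variation of `i ↦ f(x_i, y)` over the first `2^a` points of a dyadically shifted grid. -/
lemma sum_Ico_abs_sub_le {f : ℝ → ℝ → ℝ} (hfin : ∀ p, vSharp1 f (2 ^ p) ≠ ∞) {R a ξ : ℕ}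
    (ha : a ≤ R) (hξ : ξ < 2 ^ R) {θ y : ℝ} (hθ : θ ∈ I) (hy : y ∈ I) :
    ∑ i ∈ Finset.Ico 1 (2 ^ a), |f (gridPoint R θ (i ^^^ ξ)) y -
      f (gridPoint R θ ((i - 1) ^^^ ξ)) y|
      ≤ ∑ p ∈ Finset.range a, (vSharp1 f (2 ^ p)).toReal := by
  rw [sum_Ico_one_two_pow a fun i => |f (gridPoint R θ (i ^^^ ξ)) y -
      f (gridPoint R θ ((i - 1) ^^^ ξ)) y|,
    ← Finset.sum_range_reflect (fun p => (vSharp1 f (2 ^ p)).toReal)]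
  refine Finset.sum_le_sum fun k hk => ?_
  have := Finset.mem_range.1 hk
  exact sum_level_le (hfin _) (by omega) hξ hθ hy

/-! ### Dyadic addition -/

/-- The number with binary digits `e`. -/
noncomputable def ofBits (e : ℕ → ℕ) : ℝ := ∑' k, (e k : ℝ) * ((2 : ℝ) ^ (k + 1))⁻¹

lemma hasSum_inv_two_pow_succ : HasSum (fun k : ℕ => ((2 : ℝ) ^ (k + 1))⁻¹) 1 := by
  have := hasSum_geometric_two' 1
  refine this.congr_fun fun k => ?_
  rw [pow_succ]; field_simp

lemma summable_ofBits {e : ℕ → ℕ} (he : ∀ k, e k ≤ 1) :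
    Summable fun k => (e k : ℝ) * ((2 : ℝ) ^ (k + 1))⁻¹ := by
  refine Summable.of_nonneg_of_le (fun k => by positivity) (fun k => ?_)
    hasSum_inv_two_pow_succ.summable
  have : (e k : ℝ) ≤ 1 := by exact_mod_cast he k
  exact mul_le_of_le_one_left (by positivity) this

lemma ofBits_nonneg (e : ℕ → ℕ) : 0 ≤ ofBits e := tsum_nonneg fun k => by positivity

lemma ofBits_le_one {e : ℕ → ℕ} (he : ∀ k, e k ≤ 1) : ofBits e ≤ 1 := by
  rw [← hasSum_inv_two_pow_succ.tsum_eq]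
  refine (summable_ofBits he).tsum_le_tsum (fun k => ?_) hasSum_inv_two_pow_succ.summable
  have : (e k : ℝ) ≤ 1 := by exact_mod_cast he k
  exact mul_le_of_le_one_left (by positivity) this

lemma ofBits_lt_one {e : ℕ → ℕ} (he : ∀ k, e k ≤ 1) {k₀ : ℕ} (h0 : e k₀ = 0) : ofBits e < 1 := by
  rw [← hasSum_inv_two_pow_succ.tsum_eq]
  refine Summable.tsum_lt_tsum (i := k₀) (fun k => ?_) ?_ (summable_ofBits he)
    hasSum_inv_two_pow_succ.summable
  · have : (e k : ℝ) ≤ 1 := by exact_mod_cast he k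
    exact mul_le_of_le_one_left (by positivity) this
  · simp only [h0, Nat.cast_zero, zero_mul]
    positivity

lemma two_mul_ofBits {e : ℕ → ℕ} (he : ∀ k, e k ≤ 1) :
    2 * ofBits e = e 0 + ofBits (fun k => e (k + 1)) := by
  rw [ofBits, (summable_ofBits he).tsum_eq_zero_add, mul_add, ← tsum_mul_left, ofBits]
  congr 1
  · simp
    ring
  · refine tsum_congr fun k => ?_
    rw [pow_succ 2 (k + 1)]
    field_simp

lemma two_pow_mul_ofBits {e : ℕ → ℕ} (he : ∀ k, e k ≤ 1) (K : ℕ) :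
    ∃ N : ℕ, 2 ^ K * ofBits e = N + ofBits (fun k => e (K + k)) := by
  induction K with
  | zero => exact ⟨0, by simp⟩
  | succ K ih =>
    obtain ⟨N, hN⟩ := ih
    refine ⟨2 * N + e K, ?_⟩
    rw [pow_succ', mul_assoc, hN, mul_add, two_mul_ofBits fun k => he (K + k)]
    push_cast
    simp only [add_zero, add_assoc, add_comm 1]

/-- Infinitely many zeros exclude a tail of ones, so `e` is the terminating expansion that `digit`
reads. -/
lemma digit_ofBits {e : ℕ → ℕ} (he : ∀ k, e k ≤ 1) (h0 : ∀ K, ∃ k, K ≤ k ∧ e k = 0) (K : ℕ) :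
    digit (ofBits e) K = e K := by
  obtain ⟨N, hN⟩ := two_pow_mul_ofBits he K
  obtain ⟨k, hk, hk0⟩ := h0 (K + 1)
  obtain ⟨d, rfl⟩ := Nat.exists_eq_add_of_le hk
  have h2 := two_mul_ofBits fun k => he (K + k)
  have hlt : ofBits (fun k => e (K + (k + 1))) < 1 :=
    ofBits_lt_one (fun k => he _) (k₀ := d) (by rw [← hk0]; congr 1; ring)
  have hnn := ofBits_nonneg fun k => e (K + (k + 1))
  have hfl : ⌊2 ^ (K + 1) * ofBits e⌋₊ = 2 * N + e K := by
    rw [add_zero] at h2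
    rw [pow_succ', mul_assoc, hN, mul_add, h2, Nat.floor_eq_iff (by positivity)]
    push_cast
    constructor <;> linarith
  rw [digit, hfl]
  have := he K
  omega

lemma ofBits_le_of_eq_zero {K : ℕ} {e : ℕ → ℕ} (he : ∀ k, e k ≤ 1) (h0 : ∀ k < K, e k = 0) :
    ofBits e ≤ ((2 : ℝ) ^ K)⁻¹ := by
  induction K generalizing e with
  | zero => simpa using ofBits_le_one he
  | succ K ih =>
    have h := two_mul_ofBits he
    rw [h0 0 (by omega)] at h
    have := ih (e := fun k => e (k + 1)) (fun k => he _) fun k hk => h0 _ (by omega)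
    have e2 : ((2 : ℝ) ^ K)⁻¹ = 2 * ((2 : ℝ) ^ (K + 1))⁻¹ := by rw [pow_succ]; field_simp
    push_cast at h
    linarith

lemma digit_le_one (x : ℝ) (k : ℕ) : digit x k ≤ 1 := by
  have : digit x k < 2 := Nat.mod_lt _ two_pos
  omega

lemma ofBits_digit {x : ℝ} (hx : x ∈ I) : ofBits (digit x) = x := by
  have h := (Real.hasSum_ofDigitsTerm_digits x one_lt_two hx).tsum_eq
  conv_rhs => rw [← h]
  refine tsum_congr fun k => ?_
  simp [Real.ofDigitsTerm, Real.digits, digit, mul_comm]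

/-- The digits of the dyadic sum. -/
noncomputable def digitXor (x s : ℝ) (k : ℕ) : ℕ := if digit x k = digit s k then 0 else 1

lemma dyadicAdd_eq (x s : ℝ) : dyadicAdd x s = ofBits (digitXor x s) := by
  refine tsum_congr fun k => ?_
  have h1 := digit_le_one x k
  have h2 := digit_le_one s k
  congr 1
  unfold digitXor
  interval_cases digit x k <;> interval_cases digit s k <;> simp

lemma digitXor_le_one (x s : ℝ) (k : ℕ) : digitXor x s k ≤ 1 := by
  unfold digitXor; split_ifs <;> omega

/-- The points whose digits are eventually opposite to those of `x`. -/
def oppositeSet (x : ℝ) : Set ℝ := {s | s ∈ I ∧ ∃ K, ∀ k, K ≤ k → digit s k ≠ digit x k}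

lemma countable_oppositeSet (x : ℝ) : (oppositeSet x).Countable := by
  have : oppositeSet x ⊆ ⋃ K : ℕ, {s | s ∈ I ∧ ∀ k, K ≤ k → digit s k ≠ digit x k} := by
    rintro s ⟨hs, K, hK⟩
    exact mem_iUnion.2 ⟨K, hs, hK⟩
  refine (countable_iUnion fun K => ?_).mono this
  -- For fixed `K`, the first `K` digits determine the point.
  refine countable_of_injective_of_countable_image (f := fun s (k : Fin K) => digit s k) ?_
    (to_countable _)
  rintro s ⟨hs, h1⟩ t ⟨ht, h2⟩ hst
  rw [← ofBits_digit hs, ← ofBits_digit ht]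
  congr 1
  funext k
  by_cases hk : k < K
  · exact congr_fun hst ⟨k, hk⟩
  · have a1 := h1 k (not_lt.1 hk)
    have a2 := h2 k (not_lt.1 hk)
    have := digit_le_one s k
    have := digit_le_one t k
    have := digit_le_one x k
    omega

lemma dyadicAdd_mem_I {x s : ℝ} (hs : s ∈ I) (h : s ∉ oppositeSet x) : dyadicAdd x s ∈ I := by
  have : ∃ k, digit s k = digit x k := by
    by_contra! hne
    exact h ⟨hs, 0, fun k _ => hne k⟩
  obtain ⟨k, hk⟩ := this
  rw [dyadicAdd_eq]
  exact ⟨ofBits_nonneg _, ofBits_lt_one (digitXor_le_one x s) (k₀ := k) (by simp [digitXor, hk])⟩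

/-- Reaches a given point `s` as `x ∔ h` with `h = x ∔ s`, as the continuity hypothesis requires.
Outside `oppositeSet` the xored digits have no tail of ones, so they are the digits of the sum. -/
lemma dyadicAdd_dyadicAdd {x s : ℝ} (hs : s ∈ I) (h : s ∉ oppositeSet x) :
    dyadicAdd x (dyadicAdd x s) = s := by
  have h0 : ∀ K, ∃ k, K ≤ k ∧ digitXor x s k = 0 := by
    intro K
    by_contra! hne
    refine h ⟨hs, K, fun k hk hkk => hne k hk ?_⟩
    simp [digitXor, hkk]
  rw [dyadicAdd_eq x (dyadicAdd x s)]
  conv_rhs => rw [← ofBits_digit hs]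
  congr 1
  funext k
  have hd : digit (dyadicAdd x s) k = digitXor x s k := by
    rw [dyadicAdd_eq]; exact digit_ofBits (digitXor_le_one x s) h0 k
  have h1 := digit_le_one x k
  have h2 := digit_le_one s k
  rw [digitXor, hd, digitXor]
  split_ifs <;> omega

lemma dyadicAdd_le {x s : ℝ} {K : ℕ} (h : ∀ k < K, digit s k = digit x k) :
    dyadicAdd x s ≤ ((2 : ℝ) ^ K)⁻¹ := by
  rw [dyadicAdd_eq]
  exact ofBits_le_of_eq_zero (digitXor_le_one x s) fun k hk => by simp [digitXor, h k hk]

lemma digit_gridPoint {R k : ℕ} (hk : k < R) {θ : ℝ} (hθ : θ ∈ I) (a : ℕ) :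
    digit (gridPoint R θ a) k = a / 2 ^ (R - 1 - k) % 2 := by
  have e : 2 ^ (k + 1) * gridPoint R θ a = ((a : ℝ) + θ) / 2 ^ (R - 1 - k) := by
    have : (2 : ℝ) ^ R = 2 ^ (k + 1) * 2 ^ (R - 1 - k) := by
      rw [← pow_add]; congr 1; omega
    rw [gridPoint, this]; field_simp
  rw [digit, e, floor_add_div_two_pow a _ hθ]

/-- The index of the dyadic interval of length `2^{-R}` containing `x`. -/
noncomputable def gridIndex (R : ℕ) (x : ℝ) : ℕ := ⌊2 ^ R * x⌋₊

lemma gridIndex_lt {R : ℕ} {x : ℝ} (hx : x ∈ I) : gridIndex R x < 2 ^ R := by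
  have h0 := hx.1
  rw [gridIndex, Nat.floor_lt (by positivity)]
  push_cast
  exact mul_lt_of_lt_one_right (by positivity) hx.2

lemma exists_gridPoint_gridIndex (R : ℕ) {x : ℝ} (hx : x ∈ I) :
    ∃ θ ∈ I, x = gridPoint R θ (gridIndex R x) := by
  have h0 := hx.1
  refine ⟨2 ^ R * x - gridIndex R x, ⟨?_, ?_⟩, ?_⟩
  · exact sub_nonneg.2 (Nat.floor_le (by positivity))
  · rw [sub_lt_iff_lt_add']; exact Nat.lt_floor_add_one _
  · rw [gridPoint]; field_simp; ring

/-- Xor with `i < 2^L` alters only the last `L` of the first `R` digits, so the first `R - L` agree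
with those of `x`. -/
lemma dyadicAdd_gridPoint_le {R L i : ℕ} {x θ : ℝ} (hx : x ∈ I) (hθ : θ ∈ I) (hi : i < 2 ^ L) :
    dyadicAdd x (gridPoint R θ (i ^^^ gridIndex R x)) ≤ ((2 : ℝ) ^ (R - L))⁻¹ := by
  refine dyadicAdd_le fun k hk => ?_
  obtain ⟨θ', hθ', hxe⟩ := exists_gridPoint_gridIndex R hx
  conv_rhs => rw [hxe]
  rw [digit_gridPoint (by omega) hθ, digit_gridPoint (by omega) hθ', Nat.xor_div_two_pow,
    Nat.div_eq_of_lt (a := i) (hi.trans_le (Nat.pow_le_pow_right two_pos (by omega))),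
    Nat.zero_xor]

lemma DyadicContinuousAt.exists_abs_sub_le {f : ℝ → ℝ → ℝ} {x y : ℝ}
    (hc : DyadicContinuousAt f x y) (hx : x ∈ I) (hy : y ∈ I) {ε : ℝ} (hε : 0 < ε) (L : ℕ) :
    ∃ N : ℕ, ∀ R S : ℕ, N ≤ R → N ≤ S → L ≤ R → L ≤ S → ∀ θ ∈ I, ∀ τ ∈ I,
      ∀ i j : ℕ, i < 2 ^ L → j < 2 ^ L →
      gridPoint R θ (i ^^^ gridIndex R x) ∉ oppositeSet x →
      gridPoint S τ (j ^^^ gridIndex S y) ∉ oppositeSet y →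
      |f (gridPoint R θ (i ^^^ gridIndex R x)) (gridPoint S τ (j ^^^ gridIndex S y)) - f x y|
        ≤ ε := by
  have h := Metric.tendsto_nhdsWithin_nhds.1 hc ε hε
  obtain ⟨δ, hδ, h⟩ := h
  obtain ⟨M, hM⟩ := exists_pow_lt_of_lt_one hδ (by norm_num : (1 / 2 : ℝ) < 1)
  refine ⟨M + L, fun R S hR hS hLR hLS θ hθ τ hτ i j hi hj hs ht => ?_⟩
  have key : ∀ (R : ℕ) (x θ : ℝ) (i : ℕ), M + L ≤ R → L ≤ R → x ∈ I → θ ∈ I → i < 2 ^ L →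
      gridPoint R θ (i ^^^ gridIndex R x) ∉ oppositeSet x → ∃ h ∈ I, h < δ ∧
        dyadicAdd x h = gridPoint R θ (i ^^^ gridIndex R x) := by
    intro R x θ i hR hLR hx hθ hi hs
    have hmem : gridPoint R θ (i ^^^ gridIndex R x) ∈ I := gridPoint_mem_I hθ
      (Nat.xor_lt_two_pow (hi.trans_le (Nat.pow_le_pow_right two_pos hLR)) (gridIndex_lt hx))
    refine ⟨_, dyadicAdd_mem_I hmem hs, ?_, dyadicAdd_dyadicAdd hmem hs⟩
    refine (dyadicAdd_gridPoint_le hx hθ hi).trans_lt (lt_of_le_of_lt ?_ hM)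
    rw [one_div, inv_pow]
    gcongr
    · exact one_le_two
    · omega
  obtain ⟨h₁, h₁I, h₁δ, e₁⟩ := key R x θ i hR hLR hx hθ hi hs
  obtain ⟨h₂, h₂I, h₂δ, e₂⟩ := key S y τ j hS hLS hy hτ hj ht
  have := h (x := (h₁, h₂)) ⟨h₁I, h₂I⟩ (by
    rw [Prod.dist_eq, max_lt_iff]
    simp only [Real.dist_eq, sub_zero, abs_of_nonneg h₁I.1, abs_of_nonneg h₂I.1]
    exact ⟨h₁δ, h₂δ⟩)
  simp only [e₁, e₂, Real.dist_eq] at this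
  exact this.le

lemma countable_gridPoint_mem_oppositeSet (R : ℕ) (x : ℝ) :
    {θ : ℝ | ∃ a : ℕ, gridPoint R θ a ∈ oppositeSet x}.Countable := by
  rw [Set.ofPred_exists]
  refine countable_iUnion fun a => (countable_oppositeSet x).preimage_of_injOn ?_
  intro θ _ θ' _ h
  have h' : ((a : ℝ) + θ) / 2 ^ R = ((a : ℝ) + θ') / 2 ^ R := h
  rw [div_left_inj' (by positivity)] at h'
  linarith

/-! ### Integration over the dyadic grid -/

/-- The `i`-th dyadic interval of length `2^{-R}`. -/
def cell (R i : ℕ) : Set ℝ := Ico ((i : ℝ) / 2 ^ R) (((i : ℝ) + 1) / 2 ^ R)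

lemma measurableSet_cell (R i : ℕ) : MeasurableSet (cell R i) := measurableSet_Ico

lemma gridPoint_preimage_cell (R i : ℕ) : (fun θ => gridPoint R θ i) ⁻¹' cell R i = I := by
  ext θ
  have h : (0 : ℝ) < 2 ^ R := by positivity
  simp only [mem_preimage, cell, gridPoint, mem_Ico, div_le_div_iff_of_pos_right h,
    div_lt_div_iff_of_pos_right h, I]
  constructor <;> rintro ⟨h1, h2⟩ <;> constructor <;> linarith

lemma measurable_gridPoint (R i : ℕ) : Measurable fun θ => gridPoint R θ i := by
  unfold gridPoint; fun_prop

lemma map_gridPoint (R i : ℕ) :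
    (volume.restrict I).map (fun θ => gridPoint R θ i)
      = ENNReal.ofReal (2 ^ R) • volume.restrict (cell R i) := by
  ext A hA
  rw [Measure.map_apply (measurable_gridPoint R i) hA, Measure.restrict_apply
    (measurable_gridPoint R i hA), ← gridPoint_preimage_cell R i, ← preimage_inter,
    Measure.smul_apply, Measure.restrict_apply hA, smul_eq_mul]
  have e : (fun θ => gridPoint R θ i)
      = (fun t => t * ((2 : ℝ) ^ R)⁻¹) ∘ fun θ => θ + (i : ℝ) := by
    funext θ; simp [gridPoint, div_eq_mul_inv, add_comm]
  rw [e, preimage_comp, measure_preimage_add_right, Real.volume_preimage_mul_right (by positivity),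
    inv_inv, abs_of_pos (by positivity)]

lemma cell_pairwise_disjoint (R : ℕ) {i j : ℕ} (h : i ≠ j) : Disjoint (cell R i) (cell R j) := by
  wlog hij : i < j generalizing i j
  · exact (this h.symm (lt_of_le_of_ne (not_lt.1 hij) h.symm)).symm
  rw [Set.disjoint_left]
  rintro t ⟨_, h1⟩ ⟨h2, _⟩
  have h3 : (i : ℝ) + 1 ≤ j := by exact_mod_cast hij
  have : ((i : ℝ) + 1) / 2 ^ R ≤ (j : ℝ) / 2 ^ R := by gcongr
  linarith

lemma cell_subset_I {R i : ℕ} (hi : i < 2 ^ R) : cell R i ⊆ I := by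
  have hi' : (i : ℝ) + 1 ≤ 2 ^ R := by exact_mod_cast hi
  rintro t ⟨h1, h2⟩
  refine ⟨le_trans (by positivity) h1, h2.trans_le ?_⟩
  rw [div_le_one (by positivity)]
  exact hi'

lemma mem_cell_gridIndex (R : ℕ) {x : ℝ} (hx : x ∈ I) : x ∈ cell R (gridIndex R x) := by
  have h0 := hx.1
  constructor
  · rw [div_le_iff₀ (by positivity), mul_comm]
    exact Nat.floor_le (by positivity)
  · rw [lt_div_iff₀ (by positivity), mul_comm]
    exact Nat.lt_floor_add_one _

lemma I2_eq_biUnion (R S : ℕ) :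
    I2 = ⋃ p ∈ Finset.range (2 ^ R) ×ˢ Finset.range (2 ^ S), cell R p.1 ×ˢ cell S p.2 := by
  ext ⟨s, t⟩
  simp only [mem_iUnion, Finset.mem_product, Finset.mem_range, exists_prop, I2, mem_prod]
  constructor
  · rintro ⟨hs, ht⟩
    exact ⟨(gridIndex R s, gridIndex S t), ⟨gridIndex_lt hs, gridIndex_lt ht⟩,
      mem_cell_gridIndex R hs, mem_cell_gridIndex S ht⟩
  · rintro ⟨p, ⟨h1, h2⟩, h3, h4⟩
    exact ⟨cell_subset_I h1 h3, cell_subset_I h2 h4⟩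

lemma volume_restrict_I2 :
    (volume : Measure (ℝ × ℝ)).restrict I2 = (volume.restrict I).prod (volume.restrict I) := by
  rw [Measure.prod_restrict]; rfl

lemma volume_I : volume I = 1 := by simp [I]

lemma volume_I2 : volume I2 = 1 := by
  have : (volume : Measure (ℝ × ℝ)) = volume.prod volume := rfl
  rw [this, I2, Measure.prod_prod, volume_I, one_mul]

lemma map_gridPoint_prod (R S i j : ℕ) :
    (volume.restrict I2).map (Prod.map (fun θ => gridPoint R θ i) fun τ => gridPoint S τ j)
      = (ENNReal.ofReal (2 ^ R) * ENNReal.ofReal (2 ^ S)) •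
        volume.restrict (cell R i ×ˢ cell S j) := by
  rw [volume_restrict_I2, ← Measure.map_prod_map _ _ (measurable_gridPoint R i)
    (measurable_gridPoint S j), map_gridPoint, map_gridPoint, Measure.prod_smul_left,
    Measure.prod_smul_right, Measure.prod_restrict, smul_smul]
  rfl

lemma integrableOn_comp_gridPoint {h : ℝ × ℝ → ℝ} (hh : IntegrableOn h I2) {R S i j : ℕ}
    (hi : i < 2 ^ R) (hj : j < 2 ^ S) :
    IntegrableOn (fun p : ℝ × ℝ => h (gridPoint R p.1 i, gridPoint S p.2 j)) I2 := by
  have hm : Measurable (Prod.map (fun θ => gridPoint R θ i) fun τ => gridPoint S τ j) :=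
    (measurable_gridPoint R i).prodMap (measurable_gridPoint S j)
  have hint : Integrable h ((volume.restrict I2).map
      (Prod.map (fun θ => gridPoint R θ i) fun τ => gridPoint S τ j)) := by
    rw [map_gridPoint_prod]
    exact (hh.mono_set (prod_mono (cell_subset_I hi) (cell_subset_I hj))).smul_measure
      (by finiteness)
  exact (integrable_map_measure hint.1 hm.aemeasurable).1 hint

lemma setIntegral_cell {h : ℝ × ℝ → ℝ} (hh : IntegrableOn h I2) {R S i j : ℕ}
    (hi : i < 2 ^ R) (hj : j < 2 ^ S) :
    ∫ p in cell R i ×ˢ cell S j, h p = ((2 : ℝ) ^ R)⁻¹ * ((2 : ℝ) ^ S)⁻¹ *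
      ∫ p in I2, h (gridPoint R p.1 i, gridPoint S p.2 j) := by
  have hm : Measurable (Prod.map (fun θ => gridPoint R θ i) fun τ => gridPoint S τ j) :=
    (measurable_gridPoint R i).prodMap (measurable_gridPoint S j)
  have hsm : AEStronglyMeasurable h ((volume.restrict I2).map
      (Prod.map (fun θ => gridPoint R θ i) fun τ => gridPoint S τ j)) := by
    rw [map_gridPoint_prod]
    exact ((hh.mono_set (prod_mono (cell_subset_I hi) (cell_subset_I hj))).smul_measure
      (by finiteness)).1
  have := integral_map hm.aemeasurable hsm
  rw [map_gridPoint_prod, integral_smul_measure, ENNReal.toReal_mul,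
    ENNReal.toReal_ofReal (by positivity), ENNReal.toReal_ofReal (by positivity), smul_eq_mul]
    at this
  simp only [Prod.map] at this
  rw [← this]
  field_simp

/-- Exhibits the integral as an average over offsets of grid sums, so that the later estimates can
be made for each offset separately. -/
lemma setIntegral_I2_eq {h : ℝ × ℝ → ℝ} (hh : IntegrableOn h I2) (R S : ℕ) :
    ∫ p in I2, h p = ((2 : ℝ) ^ R)⁻¹ * ((2 : ℝ) ^ S)⁻¹ *
      ∑ i ∈ Finset.range (2 ^ R), ∑ j ∈ Finset.range (2 ^ S),
        ∫ p in I2, h (gridPoint R p.1 i, gridPoint S p.2 j) := by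
  rw [← Finset.sum_product', Finset.mul_sum]
  conv_lhs => rw [I2_eq_biUnion R S]
  rw [integral_biUnion_finset]
  · refine Finset.sum_congr rfl fun p hp => ?_
    rw [Finset.mem_product, Finset.mem_range, Finset.mem_range] at hp
    exact setIntegral_cell hh hp.1 hp.2
  · exact fun p _ => (measurableSet_cell R p.1).prod (measurableSet_cell S p.2)
  · intro p _ q _ hpq
    change Disjoint (cell R p.1 ×ˢ cell S p.2) (cell R q.1 ×ˢ cell S q.2)
    rw [Set.disjoint_prod]
    by_cases h1 : p.1 = q.1
    · right
      exact cell_pairwise_disjoint S fun h2 => hpq (Prod.ext h1 h2)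
    · left
      exact cell_pairwise_disjoint R h1
  · intro p hp
    rw [Finset.mem_product, Finset.mem_range, Finset.mem_range] at hp
    exact hh.mono_set (prod_mono (cell_subset_I hp.1) (cell_subset_I hp.2))

/-! ### The Cesàro means as integrals against the kernel -/

lemma measurable_walsh (k : ℕ) : Measurable (walsh k) := by
  have h : walsh k = fun u => ∏ t ∈ Finset.range k, if k.testBit t then rademacher t u else 1 :=
    funext fun u => walsh_eq_prod k.lt_two_pow_self u
  rw [h]
  refine Finset.measurable_fun_prod _ fun t _ => ?_
  split_ifs
  · unfold rademacher r0
    refine Measurable.ite ?_ measurable_const measurable_const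
    exact measurableSet_lt (by fun_prop) measurable_const
  · exact measurable_const

lemma integrableOn_mul_walsh {f : ℝ → ℝ → ℝ} (hf : IntegrableOn (Function.uncurry f) I2)
    (k l : ℕ) :
    IntegrableOn (fun p : ℝ × ℝ => f p.1 p.2 * walsh k p.1 * walsh l p.2) I2 := by
  refine Integrable.mul_bdd (c := 1) (Integrable.mul_bdd (c := 1) hf ?_ ?_) ?_ ?_
  · exact ((measurable_walsh k).comp measurable_fst).aestronglyMeasurable
  · exact Eventually.of_forall fun p => by rw [Real.norm_eq_abs, abs_walsh]
  · exact ((measurable_walsh l).comp measurable_snd).aestronglyMeasurable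
  · exact Eventually.of_forall fun p => by rw [Real.norm_eq_abs, abs_walsh]

lemma measurableSet_I2 : MeasurableSet I2 := measurableSet_Ico.prod measurableSet_Ico

lemma coeff_eq {f : ℝ → ℝ → ℝ} (hf : IntegrableOn (Function.uncurry f) I2) {k l R S : ℕ}
    (hk : k < 2 ^ R) (hl : l < 2 ^ S) :
    coeff f k l = ((2 : ℝ) ^ R)⁻¹ * ((2 : ℝ) ^ S)⁻¹ *
      ∑ i ∈ Finset.range (2 ^ R), ∑ j ∈ Finset.range (2 ^ S),
        (∫ p in I2, f (gridPoint R p.1 i) (gridPoint S p.2 j)) *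
          (gridWalsh R k i * gridWalsh S l j) := by
  rw [coeff, setIntegral_I2_eq (integrableOn_mul_walsh hf k l) R S]
  congr 1
  refine Finset.sum_congr rfl fun i _ => Finset.sum_congr rfl fun j _ => ?_
  rw [← integral_mul_const]
  refine setIntegral_congr_fun measurableSet_I2 fun p hp => ?_
  simp only [gridPoint]
  rw [walsh_eq_gridWalsh hk i hp.1, walsh_eq_gridWalsh hl j hp.2]
  ring

lemma walsh_eq_gridWalsh_gridIndex {k R : ℕ} (hk : k < 2 ^ R) {x : ℝ} (hx : x ∈ I) :
    walsh k x = gridWalsh R k (gridIndex R x) := by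
  obtain ⟨θ, hθ, hxe⟩ := exists_gridPoint_gridIndex R hx
  conv_lhs => rw [hxe]
  exact walsh_eq_gridWalsh hk _ hθ

lemma sum_Icc_cesaroNumber_mul (a : ℝ) (n : ℕ) (φ : ℕ → ℝ) :
    ∑ i ∈ Finset.Icc 1 n, cesaroNumber (a - 1) (n - i) * ∑ k ∈ Finset.range i, φ k
      = ∑ k ∈ Finset.range n, cesaroNumber a (n - 1 - k) * φ k := by
  have h1 : ∑ i ∈ Finset.Icc 1 n, cesaroNumber (a - 1) (n - i) * ∑ k ∈ Finset.range i, φ k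
      = ∑ i ∈ Finset.Icc 1 n, ∑ k ∈ Finset.range i, cesaroNumber (a - 1) (n - i) * φ k :=
    Finset.sum_congr rfl fun i _ => Finset.mul_sum _ _ _
  rw [h1, Finset.sum_comm' (t' := Finset.range n) (s' := fun k => Finset.Icc (k + 1) n)]
  · refine Finset.sum_congr rfl fun k hk => ?_
    have hk' := Finset.mem_range.1 hk
    rw [← Finset.sum_mul, ← sum_cesaroNumber_sub_one]
    congr 1
    refine Finset.sum_bij' (fun i _ => n - i) (fun i _ => n - i) ?_ ?_ ?_ ?_ ?_
    all_goals intro i hi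
    all_goals simp only [Finset.mem_Icc, Finset.mem_range] at *
    all_goals omega
  · intro i k
    simp only [Finset.mem_Icc, Finset.mem_range]
    omega

lemma cesaroMean_eq_sum (a b : ℝ) (f : ℝ → ℝ → ℝ) (n m : ℕ) (x y : ℝ) :
    cesaroMean a b f n m x y = ∑ k ∈ Finset.range n, ∑ l ∈ Finset.range m,
      (cesaroNumber a (n - 1 - k) / cesaroNumber a (n - 1)) *
      (cesaroNumber b (m - 1 - l) / cesaroNumber b (m - 1)) *
      (coeff f k l * walsh k x * walsh l y) := by
  have h1 : ∑ i ∈ Finset.Icc 1 n, ∑ j ∈ Finset.Icc 1 m,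
      cesaroNumber (a - 1) (n - i) * cesaroNumber (b - 1) (m - j) * partialSum f i j x y
      = ∑ k ∈ Finset.range n, cesaroNumber a (n - 1 - k) * ∑ l ∈ Finset.range m,
        cesaroNumber b (m - 1 - l) * (coeff f k l * walsh k x * walsh l y) := by
    rw [← sum_Icc_cesaroNumber_mul]
    refine Finset.sum_congr rfl fun i _ => ?_
    have h2 : ∀ k, ∑ l ∈ Finset.range m,
        cesaroNumber b (m - 1 - l) * (coeff f k l * walsh k x * walsh l y)
        = ∑ j ∈ Finset.Icc 1 m, cesaroNumber (b - 1) (m - j) *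
          ∑ l ∈ Finset.range j, coeff f k l * walsh k x * walsh l y :=
      fun k => (sum_Icc_cesaroNumber_mul b m _).symm
    simp only [h2]
    rw [Finset.sum_comm, Finset.mul_sum]
    refine Finset.sum_congr rfl fun j _ => ?_
    rw [partialSum, ← Finset.mul_sum]
    ring
  rw [cesaroMean, h1, Finset.mul_sum]
  refine Finset.sum_congr rfl fun k _ => ?_
  rw [Finset.mul_sum, Finset.mul_sum]
  refine Finset.sum_congr rfl fun l _ => ?_
  ring

lemma sum_range_two_pow_xor {R ξ : ℕ} (hξ : ξ < 2 ^ R) (F : ℕ → ℝ) :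
    ∑ i ∈ Finset.range (2 ^ R), F i = ∑ i ∈ Finset.range (2 ^ R), F (i ^^^ ξ) := by
  have hmem : ∀ i ∈ Finset.range (2 ^ R), i ^^^ ξ ∈ Finset.range (2 ^ R) := fun i hi =>
    Finset.mem_range.2 (Nat.xor_lt_two_pow (Finset.mem_range.1 hi) hξ)
  refine Finset.sum_bij' (fun i _ => i ^^^ ξ) (fun i _ => i ^^^ ξ) hmem hmem ?_ ?_ ?_
  all_goals intro i _
  all_goals simp

/-- Reindexing by xor with the indices of `x` and `y` makes `w_k(x)` appear twice; its square is 1,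
and the kernel is left at the untranslated index. -/
theorem cesaroMean_eq_sum_gridKernel {α β : ℝ} {f : ℝ → ℝ → ℝ}
    (hf : IntegrableOn (Function.uncurry f) I2)
    {n m R S : ℕ} (hn : n ≤ 2 ^ R) (hm : m ≤ 2 ^ S) {x y : ℝ} (hx : x ∈ I) (hy : y ∈ I) :
    cesaroMean (-α) (-β) f n m x y
      = ∑ i ∈ Finset.range (2 ^ R), ∑ j ∈ Finset.range (2 ^ S),
        (∫ p in I2, f (gridPoint R p.1 (i ^^^ gridIndex R x))
          (gridPoint S p.2 (j ^^^ gridIndex S y))) *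
        (gridKernel α n R i * gridKernel β m S j) := by
  set ξ := gridIndex R x with hξ
  set η := gridIndex S y with hη
  have hξR : ξ < 2 ^ R := gridIndex_lt hx
  have hηS : η < 2 ^ S := gridIndex_lt hy
  set F : ℕ → ℕ → ℝ := fun i j => ∫ p in I2, f (gridPoint R p.1 i) (gridPoint S p.2 j) with hF
  set c : ℕ → ℝ := fun k => cesaroNumber (-α) (n - 1 - k) / cesaroNumber (-α) (n - 1) with hc
  set d : ℕ → ℝ := fun l => cesaroNumber (-β) (m - 1 - l) / cesaroNumber (-β) (m - 1) with hd
  have hterm : ∀ k ∈ Finset.range n, ∀ l ∈ Finset.range m,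
      c k * d l * (coeff f k l * walsh k x * walsh l y)
      = ∑ i ∈ Finset.range (2 ^ R), ∑ j ∈ Finset.range (2 ^ S), F (i ^^^ ξ) (j ^^^ η) *
        (c k * gridWalsh R k i / 2 ^ R * (d l * gridWalsh S l j / 2 ^ S)) := by
    intro k hk l hl
    have hkR := (Finset.mem_range.1 hk).trans_le hn
    have hlS := (Finset.mem_range.1 hl).trans_le hm
    rw [coeff_eq hf hkR hlS, walsh_eq_gridWalsh_gridIndex hkR hx,
      walsh_eq_gridWalsh_gridIndex hlS hy, sum_range_two_pow_xor hξR]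
    rw [Finset.sum_congr rfl fun i _ => sum_range_two_pow_xor hηS _]
    simp only [← gridWalsh_mul hkR, ← gridWalsh_mul hlS]
    have e1 : gridWalsh R k ξ * gridWalsh R k ξ = 1 := by
      rw [gridWalsh_mul hkR]; simp [gridWalsh_eq_prod hkR, bitSign]
    have e2 : gridWalsh S l η * gridWalsh S l η = 1 := by
      rw [gridWalsh_mul hlS]; simp [gridWalsh_eq_prod hlS, bitSign]
    simp only [Finset.mul_sum, Finset.sum_mul]
    refine Finset.sum_congr rfl fun i _ => Finset.sum_congr rfl fun j _ => ?_
    rw [← hξ, ← hη]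
    calc _ = F (i ^^^ ξ) (j ^^^ η) * (c k * gridWalsh R k i * ((2 : ℝ) ^ R)⁻¹ *
          (d l * gridWalsh S l j * ((2 : ℝ) ^ S)⁻¹)) *
          (gridWalsh R k ξ * gridWalsh R k ξ) * (gridWalsh S l η * gridWalsh S l η) := by
          simp only [hF]; ring
      _ = _ := by rw [e1, e2]; simp only [div_eq_mul_inv]; ring
  rw [cesaroMean_eq_sum, Finset.sum_congr rfl fun k hk => Finset.sum_congr rfl (hterm k hk),
    Finset.sum_congr rfl fun k _ => Finset.sum_comm, Finset.sum_comm]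
  refine Finset.sum_congr rfl fun i _ => ?_
  rw [Finset.sum_congr rfl fun k _ => Finset.sum_comm, Finset.sum_comm]
  refine Finset.sum_congr rfl fun j _ => ?_
  rw [gridKernel, gridKernel, Finset.sum_div, Finset.sum_div, Finset.sum_mul_sum, Finset.mul_sum]
  refine Finset.sum_congr rfl fun k _ => ?_
  rw [Finset.mul_sum]

theorem cesaroMean_sub_eq_integral {α β : ℝ} (hα : α ∈ Ioo (0 : ℝ) 1) (hβ : β ∈ Ioo (0 : ℝ) 1)
    {f : ℝ → ℝ → ℝ} (hf : IntegrableOn (Function.uncurry f) I2)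
    {n m R S : ℕ} (hn0 : 0 < n) (hm0 : 0 < m) (hn : n ≤ 2 ^ R) (hm : m ≤ 2 ^ S) {x y : ℝ}
    (hx : x ∈ I) (hy : y ∈ I) :
    cesaroMean (-α) (-β) f n m x y - f x y
      = ∫ p in I2, ∑ i ∈ Finset.range (2 ^ R), ∑ j ∈ Finset.range (2 ^ S),
        (f (gridPoint R p.1 (i ^^^ gridIndex R x)) (gridPoint S p.2 (j ^^^ gridIndex S y))
          - f x y) * (gridKernel α n R i * gridKernel β m S j) := by
  have hone : ∑ i ∈ Finset.range (2 ^ R), ∑ j ∈ Finset.range (2 ^ S),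
      (gridKernel α n R i * gridKernel β m S j) = 1 := by
    rw [← Finset.sum_mul_sum, sum_gridKernel hα hn0 hn, sum_gridKernel hβ hm0 hm, one_mul]
  have hfin : volume I2 ≠ ∞ := by rw [volume_I2]; simp
  have hint : ∀ i ∈ Finset.range (2 ^ R), ∀ j ∈ Finset.range (2 ^ S),
      IntegrableOn (fun p : ℝ × ℝ =>
        f (gridPoint R p.1 (i ^^^ gridIndex R x)) (gridPoint S p.2 (j ^^^ gridIndex S y))) I2 := by
    intro i hi j hj
    exact integrableOn_comp_gridPoint hf
      (Nat.xor_lt_two_pow (Finset.mem_range.1 hi) (gridIndex_lt hx))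
      (Nat.xor_lt_two_pow (Finset.mem_range.1 hj) (gridIndex_lt hy))
  have hint' : ∀ i ∈ Finset.range (2 ^ R), ∀ j ∈ Finset.range (2 ^ S),
      IntegrableOn (fun p : ℝ × ℝ =>
        (f (gridPoint R p.1 (i ^^^ gridIndex R x)) (gridPoint S p.2 (j ^^^ gridIndex S y))
          - f x y) * (gridKernel α n R i * gridKernel β m S j)) I2 := fun i hi j hj =>
    ((hint i hi j hj).sub (integrableOn_const hfin)).mul_const _
  rw [cesaroMean_eq_sum_gridKernel hf hn hm hx hy,
    integral_finsetSum _ fun i hi => integrable_finsetSum _ fun j hj => hint' i hi j hj]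
  conv_lhs => rw [← mul_one (f x y), ← hone]
  rw [Finset.mul_sum, ← Finset.sum_sub_distrib]
  refine Finset.sum_congr rfl fun i hi => ?_
  rw [integral_finsetSum _ fun j hj => hint' i hi j hj, Finset.mul_sum, ← Finset.sum_sub_distrib]
  refine Finset.sum_congr rfl fun j hj => ?_
  rw [integral_mul_const, integral_sub (hint i hi j hj) (integrableOn_const hfin),
    setIntegral_const, Measure.real, volume_I2]
  simp
  ring

/-! ### Estimates for double sums over the dyadic grid -/

/-- At `j = 0` the truncated `j - 1` merely repeats a nonnegative term. -/
lemma abs_mixedDiff_le (G : ℕ → ℕ → ℝ) {i : ℕ} (hi : i ≠ 0) (j : ℕ) :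
    |mixedDiff G i j| ≤ |G i j - G (i - 1) j| + |G i (j - 1) - G (i - 1) (j - 1)| := by
  unfold mixedDiff backDiff
  by_cases hj : j = 0
  · simp [hi, hj]
  · simp only [hi, hj, if_false]
    refine le_trans (le_of_eq ?_) (abs_sub _ _)
    congr 1; ring

lemma abs_mixedDiff_le_of_le (G : ℕ → ℕ → ℝ) {e : ℝ} {M N : ℕ}
    (h : ∀ i j, i < M → j < N → |G i j| ≤ e) {i j : ℕ} (hi : i < M) (hj : j < N) :
    |mixedDiff G i j| ≤ 4 * e := by
  have h1 := abs_le.1 (h i j hi hj)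
  have h2 := abs_le.1 (h (i - 1) j (by omega) hj)
  have h3 := abs_le.1 (h i (j - 1) hi (by omega))
  have h4 := abs_le.1 (h (i - 1) (j - 1) (by omega) (by omega))
  unfold mixedDiff backDiff
  rw [abs_le]
  split_ifs <;> constructor <;> linarith

lemma sum_abs_mixedDiff_le {G : ℕ → ℕ → ℝ} {a S : ℕ} {U : ℝ}
    (h : ∀ j < 2 ^ S, ∑ i ∈ Finset.Ico 1 (2 ^ a), |G i j - G (i - 1) j| ≤ U) {j : ℕ}
    (hj : j < 2 ^ S) : ∑ i ∈ Finset.Ico 1 (2 ^ a), |mixedDiff G i j| ≤ 2 * U := by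
  calc _ ≤ ∑ i ∈ Finset.Ico 1 (2 ^ a),
        (|G i j - G (i - 1) j| + |G i (j - 1) - G (i - 1) (j - 1)|) :=
        Finset.sum_le_sum fun i hi =>
          abs_mixedDiff_le G (by have := (Finset.mem_Ico.1 hi).1; omega) j
    _ ≤ U + U := by
        rw [Finset.sum_add_distrib]
        exact add_le_add (h j hj) (h (j - 1) (by omega))
    _ = _ := by ring

/-- There are `2^a` indices of size `a + 1`, so this is a geometric sum of ratio `2ρ > 1`, dominated
by its last term. The constant is chosen to close the induction. -/
lemma sum_pow_size_le {ρ : ℝ} (hρ : 1 < 2 * ρ) (a : ℕ) :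
    ∑ j ∈ Finset.range (2 ^ a), ρ ^ j.size
      ≤ (1 + 2 * ρ / (2 * (2 * ρ - 1))) * (2 * ρ) ^ a := by
  have hpos : 0 < 2 * ρ - 1 := by linarith
  induction a with
  | zero => simp; positivity
  | succ a ih =>
    rw [pow_succ 2 a, mul_two, Finset.sum_range_add]
    have e : ∀ j ∈ Finset.range (2 ^ a), ρ ^ (2 ^ a + j).size = ρ ^ (a + 1) := by
      intro j hj
      have hj' := Finset.mem_range.1 hj
      congr 1
      refine le_antisymm (Nat.size_le.2 ?_) (Nat.lt_size.2 (Nat.le_add_right _ _))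
      rw [pow_succ]; omega
    rw [Finset.sum_congr rfl e]
    simp only [Finset.sum_const, Finset.card_range, nsmul_eq_mul]
    push_cast
    have hx : (0 : ℝ) < (2 * ρ) ^ a := by apply pow_pos; linarith
    calc _ ≤ (1 + 2 * ρ / (2 * (2 * ρ - 1))) * (2 * ρ) ^ a + 2 ^ a * ρ ^ (a + 1) := by gcongr
      _ = (1 + 2 * ρ / (2 * (2 * ρ - 1)) + ρ) * (2 * ρ) ^ a := by rw [mul_pow]; ring
      _ ≤ ((1 + 2 * ρ / (2 * (2 * ρ - 1))) * (2 * ρ)) * (2 * ρ) ^ a := by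
          gcongr
          have : (1 + 2 * ρ / (2 * (2 * ρ - 1))) * (2 * ρ)
              - (1 + 2 * ρ / (2 * (2 * ρ - 1)) + ρ) = 2 * ρ - 1 := by
            field_simp; ring
          linarith
      _ = _ := by ring

/-- Group by `a = size i`: the differences in `i` sum to at most `2 U a` for each `j`, and the
weights over `j < 2^a` contribute `O((2ρ')^a)`. -/
lemma sum_large_le {G : ℕ → ℕ → ℝ} {R S L : ℕ} {U : ℕ → ℝ} {ρ ρ' : ℝ} (hρ0 : 0 ≤ ρ)
    (hρ' : 1 < 2 * ρ')
    (h : ∀ a ≤ R, ∀ j < 2 ^ S, ∑ i ∈ Finset.Ico 1 (2 ^ a), |G i j - G (i - 1) j| ≤ U a) :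
    ∑ i ∈ Finset.range (2 ^ R), ∑ j ∈ Finset.range (2 ^ S),
      (if L < i.size ∧ j.size ≤ i.size then |mixedDiff G i j| * (ρ ^ i.size * ρ' ^ j.size) else 0)
    ≤ 2 * (1 + 2 * ρ' / (2 * (2 * ρ' - 1))) *
      ∑ a ∈ Finset.range (R + 1), if L < a then U a * (2 * ρ * ρ') ^ a else 0 := by
  have hρ'0 : 0 < ρ' := by linarith
  have hmap : ∀ i ∈ Finset.range (2 ^ R), i.size ∈ Finset.range (R + 1) := fun i hi =>
    Finset.mem_range.2 (Nat.lt_succ_of_le (Nat.size_le.2 (Finset.mem_range.1 hi)))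
  rw [← Finset.sum_fiberwise_of_maps_to hmap, Finset.mul_sum]
  refine Finset.sum_le_sum fun a ha => ?_
  have haR : a ≤ R := Nat.lt_succ_iff.1 (Finset.mem_range.1 ha)
  by_cases hLa : L < a
  · rw [if_pos hLa]
    have hU : 0 ≤ U a := (Finset.sum_nonneg fun _ _ => abs_nonneg _).trans
      (h a haR 0 (by positivity))
    calc _ ≤ ∑ i ∈ Finset.range (2 ^ R) with i.size = a,
          ∑ j ∈ Finset.range (2 ^ S) with j.size ≤ a, |mixedDiff G i j| * (ρ ^ a * ρ' ^ j.size) := by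
          refine Finset.sum_le_sum fun i hi => ?_
          have hia := (Finset.mem_filter.1 hi).2
          rw [Finset.sum_filter]
          refine Finset.sum_le_sum fun j _ => ?_
          simp only [hia, hLa, true_and, le_refl]
      _ = ∑ j ∈ Finset.range (2 ^ S) with j.size ≤ a, (ρ ^ a * ρ' ^ j.size) *
            ∑ i ∈ Finset.range (2 ^ R) with i.size = a, |mixedDiff G i j| := by
          rw [Finset.sum_comm]
          refine Finset.sum_congr rfl fun j _ => ?_
          rw [Finset.mul_sum]
          exact Finset.sum_congr rfl fun i _ => mul_comm _ _
      _ ≤ ∑ j ∈ Finset.range (2 ^ S) with j.size ≤ a, (ρ ^ a * ρ' ^ j.size) * (2 * U a) := by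
          refine Finset.sum_le_sum fun j hj => ?_
          have hjS := Finset.mem_range.1 (Finset.mem_filter.1 hj).1
          gcongr
          refine le_trans ?_ (sum_abs_mixedDiff_le (h a haR) hjS)
          refine Finset.sum_le_sum_of_subset_of_nonneg (fun i hi => ?_) fun _ _ _ => abs_nonneg _
          have hia := (Finset.mem_filter.1 hi).2
          rw [Finset.mem_Ico]
          exact ⟨Nat.size_pos.1 (by omega), Nat.size_le.1 hia.le⟩
      _ ≤ ∑ j ∈ Finset.range (2 ^ a), (ρ ^ a * ρ' ^ j.size) * (2 * U a) := by
          refine Finset.sum_le_sum_of_subset_of_nonneg (fun j hj => ?_) fun _ _ _ => by positivity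
          exact Finset.mem_range.2 (Nat.size_le.1 (Finset.mem_filter.1 hj).2)
      _ = ρ ^ a * (2 * U a) * ∑ j ∈ Finset.range (2 ^ a), ρ' ^ j.size := by
          rw [Finset.mul_sum]
          exact Finset.sum_congr rfl fun _ _ => by ring
      _ ≤ ρ ^ a * (2 * U a) * ((1 + 2 * ρ' / (2 * (2 * ρ' - 1))) * (2 * ρ') ^ a) := by
          gcongr
          exact sum_pow_size_le hρ' a
      _ = _ := by rw [mul_pow, mul_pow, mul_pow]; ring
  · rw [if_neg hLa, mul_zero]
    refine le_of_eq (Finset.sum_eq_zero fun i hi => Finset.sum_eq_zero fun j _ => ?_)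
    rw [if_neg]
    rw [(Finset.mem_filter.1 hi).2]
    exact fun h => hLa h.1

/-- The bound for a double sum against two kernels with decaying tails. -/
lemma abs_sum_sum_le {G : ℕ → ℕ → ℝ} {k k' : ℕ → ℝ} {R S L : ℕ} {U U' : ℕ → ℝ}
    {ρ ρ' C C' e : ℝ} (hρ : 1 < 2 * ρ) (hρ1 : ρ ≤ 1) (hρ' : 1 < 2 * ρ') (hρ'1 : ρ' ≤ 1)
    (hC : 0 ≤ C) (hC' : 0 ≤ C') (hLR : L ≤ R) (hLS : L ≤ S)
    (hk : ∀ i < 2 ^ R, |∑ i' ∈ Finset.Ico i (2 ^ R), k i'| ≤ C * ρ ^ i.size)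
    (hk' : ∀ j < 2 ^ S, |∑ j' ∈ Finset.Ico j (2 ^ S), k' j'| ≤ C' * ρ' ^ j.size)
    (hU : ∀ a ≤ R, ∀ j < 2 ^ S, ∑ i ∈ Finset.Ico 1 (2 ^ a), |G i j - G (i - 1) j| ≤ U a)
    (hU' : ∀ a ≤ S, ∀ i < 2 ^ R, ∑ j ∈ Finset.Ico 1 (2 ^ a), |G i j - G i (j - 1)| ≤ U' a)
    (he : ∀ i j, i < 2 ^ L → j < 2 ^ L → |G i j| ≤ e) :
    |∑ i ∈ Finset.range (2 ^ R), ∑ j ∈ Finset.range (2 ^ S), G i j * (k i * k' j)|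
      ≤ C * C' * (2 ^ L * (2 ^ L * (4 * e)) +
        2 * (1 + 2 * ρ' / (2 * (2 * ρ' - 1))) *
          (∑ a ∈ Finset.range (R + 1), if L < a then U a * (2 * ρ * ρ') ^ a else 0) +
        2 * (1 + 2 * ρ / (2 * (2 * ρ - 1))) *
          (∑ a ∈ Finset.range (S + 1), if L < a then U' a * (2 * ρ * ρ') ^ a else 0)) := by
  have hρ0 : 0 < ρ := by linarith
  have hρ'0 : 0 < ρ' := by linarith
  rw [sum_sum_mul_eq]
  refine (Finset.abs_sum_le_sum_abs _ _).trans ?_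
  have he0 : 0 ≤ e := (abs_nonneg _).trans (he 0 0 (by positivity) (by positivity))
  have hstep : ∀ i ∈ Finset.range (2 ^ R), |∑ j ∈ Finset.range (2 ^ S), mixedDiff G i j *
      ((∑ i' ∈ Finset.Ico i (2 ^ R), k i') * ∑ j' ∈ Finset.Ico j (2 ^ S), k' j')|
      ≤ ∑ j ∈ Finset.range (2 ^ S), C * C' *
        ((if i < 2 ^ L ∧ j < 2 ^ L then 4 * e else 0) +
        (if L < i.size ∧ j.size ≤ i.size then
          |mixedDiff G i j| * (ρ ^ i.size * ρ' ^ j.size) else 0) +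
        (if L < j.size ∧ i.size ≤ j.size then
          |mixedDiff G i j| * (ρ ^ i.size * ρ' ^ j.size) else 0)) := by
    intro i hi
    refine (Finset.abs_sum_le_sum_abs _ _).trans (Finset.sum_le_sum fun j hj => ?_)
    have hi' := Finset.mem_range.1 hi
    have hj' := Finset.mem_range.1 hj
    rw [abs_mul, abs_mul]
    have ht0 : 0 ≤ |mixedDiff G i j| * (ρ ^ i.size * ρ' ^ j.size) := by positivity
    calc _ ≤ |mixedDiff G i j| * ((C * ρ ^ i.size) * (C' * ρ' ^ j.size)) := by
          gcongr
          · exact hk i hi'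
          · exact hk' j hj'
      _ = C * C' * (|mixedDiff G i j| * (ρ ^ i.size * ρ' ^ j.size)) := by ring
      _ ≤ _ := by
          refine mul_le_mul_of_nonneg_left ?_ (by positivity)
          -- Every pair lies in the corner or has its larger size above `L`. The two outer regions
          -- overlap when sizes agree, harmlessly since all terms are nonnegative.
          by_cases h1 : i < 2 ^ L ∧ j < 2 ^ L
          · rw [if_pos h1]
            have hd := abs_mixedDiff_le_of_le G he h1.1 h1.2
            have hle : |mixedDiff G i j| * (ρ ^ i.size * ρ' ^ j.size) ≤ 4 * e * (1 * 1) := by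
              gcongr
              · exact pow_le_one₀ hρ0.le hρ1
              · exact pow_le_one₀ hρ'0.le hρ'1
            split_ifs <;> linarith
          · rw [if_neg h1, ← Nat.size_le, ← Nat.size_le] at *
            split_ifs with h2 h3 h3
            · linarith
            · linarith
            · linarith
            · omega
  refine (Finset.sum_le_sum hstep).trans ?_
  simp only [← Finset.mul_sum, Finset.sum_add_distrib]
  refine mul_le_mul_of_nonneg_left ?_ (by positivity)
  refine add_le_add (add_le_add ?_ ?_) ?_
  · have hone : ∀ n : ℕ, L ≤ n → ∀ g : ℕ → ℝ,
        ∑ i ∈ Finset.range (2 ^ n), (if i < 2 ^ L then g i else 0)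
        = ∑ i ∈ Finset.range (2 ^ L), g i := by
      intro n hn g
      rw [← Finset.sum_filter]
      congr 1
      ext i
      have : 2 ^ L ≤ 2 ^ n := Nat.pow_le_pow_right two_pos hn
      simp only [Finset.mem_filter, Finset.mem_range]
      omega
    simp only [ite_and]
    have e1 : ∀ i, ∑ j ∈ Finset.range (2 ^ S),
        (if i < 2 ^ L then (if j < 2 ^ L then 4 * e else 0) else 0)
        = if i < 2 ^ L then 2 ^ L * (4 * e) else 0 := by
      intro i
      split_ifs
      · rw [hone S hLS]; simp
      · simp
    simp only [e1]
    rw [hone R hLR]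
    simp
  · exact sum_large_le hρ0.le hρ' hU
  · have := sum_large_le (G := fun i j => G j i) (L := L) hρ'0.le hρ hU'
    rw [Finset.sum_comm]
    refine le_trans (le_of_eq ?_) (this.trans (le_of_eq ?_))
    · refine Finset.sum_congr rfl fun j _ => Finset.sum_congr rfl fun i _ => ?_
      rw [mixedDiff_swap, mul_comm (ρ ^ _)]
    · congr 1
      refine Finset.sum_congr rfl fun a _ => ?_
      rw [show 2 * ρ' * ρ = 2 * ρ * ρ' by ring]

/-! ### Summability -/

/-- Writing `w^a = w^p w^{a-p}` bounds the series by the Cauchy product with a geometric series. -/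
lemma summable_sum_range_mul_pow {V : ℕ → ℝ} (hV : ∀ p, 0 ≤ V p) {w : ℝ} (hw0 : 0 < w)
    (hw1 : w < 1) (h : Summable fun p => V p * w ^ p) :
    Summable fun a => (∑ p ∈ Finset.range a, V p) * w ^ a := by
  have hg : Summable fun q : ℕ => w ^ q := summable_geometric_of_lt_one hw0.le hw1
  have hprod := summable_norm_sum_mul_antidiagonal_of_summable_norm h.norm hg.norm
  refine Summable.of_nonneg_of_le (fun a => ?_) (fun a => ?_) hprod
  · exact mul_nonneg (Finset.sum_nonneg fun p _ => hV p) (by positivity)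
  · refine le_trans ?_ (Real.le_norm_self _)
    rw [Finset.Nat.sum_antidiagonal_eq_sum_range_succ_mk, Finset.sum_mul]
    refine le_trans (le_of_eq ?_) (Finset.sum_le_sum_of_subset_of_nonneg
      (Finset.range_mono (Nat.le_succ a)) fun p _ _ => by have := hV p; positivity)
    refine Finset.sum_congr rfl fun p hp => ?_
    have hp' := Finset.mem_range.1 hp
    rw [mul_assoc, ← pow_add]
    congr 2; omega

lemma exists_sum_ite_lt {F : ℕ → ℝ} (hF0 : ∀ a, 0 ≤ F a) (hF : Summable F) {ε : ℝ} (hε : 0 < ε) :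
    ∃ L₀ : ℕ, ∀ L, L₀ ≤ L → ∀ n, ∑ a ∈ Finset.range n, (if L < a then F a else 0) ≤ ε := by
  have h := (tendsto_order.1 (tendsto_sum_nat_add F)).2 ε hε
  obtain ⟨L₀, hL₀⟩ := eventually_atTop.1 h
  refine ⟨L₀, fun L hL n => ?_⟩
  have hL1 := hL₀ (L + 1) (by omega)
  calc _ ≤ ∑ a ∈ Finset.range (L + 1 + n), (if L < a then F a else 0) :=
        Finset.sum_le_sum_of_subset_of_nonneg (Finset.range_mono (by omega)) fun a _ _ => by
          split_ifs
          · exact hF0 a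
          · exact le_rfl
    _ = ∑ a ∈ Finset.range n, F (a + (L + 1)) := by
        rw [Finset.sum_range_add, Finset.sum_eq_zero, zero_add]
        · refine Finset.sum_congr rfl fun a _ => ?_
          rw [if_pos (by omega), add_comm]
        · intro a ha
          rw [if_neg (by have := Finset.mem_range.1 ha; omega)]
    _ ≤ ∑' a, F (a + (L + 1)) :=
        ((summable_nat_add_iff (L + 1)).2 hF).sum_le_tsum _ fun a _ => hF0 _
    _ ≤ ε := hL1.le

lemma vSharp1_ne_top {f : ℝ → ℝ → ℝ} {γ : ℝ}
    (h : ∑' j : ℕ, vSharp1 f (2 ^ (j + 1)) /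
      ENNReal.ofReal ((2 : ℝ) ^ (((j : ℝ) + 1) * (1 - γ))) < ∞) (p : ℕ) :
    vSharp1 f (2 ^ p) ≠ ∞ := by
  have key : ∀ j : ℕ, vSharp1 f (2 ^ (j + 1)) ≠ ∞ := by
    intro j hj
    have := ENNReal.ne_top_of_tsum_ne_top h.ne j
    rw [hj, ENNReal.top_div_of_ne_top ENNReal.ofReal_ne_top] at this
    exact this rfl
  cases p with
  | zero => exact ((vSharp1_one_le_two f).trans_lt (lt_top_iff_ne_top.2 (key 0))).ne
  | succ j => exact key j

lemma summable_vSharp1 {f : ℝ → ℝ → ℝ} {γ : ℝ}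
    (h : ∑' j : ℕ, vSharp1 f (2 ^ (j + 1)) /
      ENNReal.ofReal ((2 : ℝ) ^ (((j : ℝ) + 1) * (1 - γ))) < ∞) :
    Summable fun p => (vSharp1 f (2 ^ p)).toReal * ((2 : ℝ) ^ (γ - 1)) ^ p := by
  rw [← summable_nat_add_iff 1]
  refine (ENNReal.summable_toReal h.ne).congr fun j => ?_
  rw [ENNReal.toReal_div, ENNReal.toReal_ofReal (by positivity), div_eq_mul_inv,
    ← Real.rpow_neg two_pos.le, ← Real.rpow_natCast, ← Real.rpow_mul two_pos.le]
  congr 2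
  push_cast
  ring

/-! ### Convergence of the Cesàro means -/

/-- Finite one-interval variations bound `f`, through the path from `(0,0)` to `(0,y)` to `(x,y)`.
-/
lemma integrableOn_of_vSharp {f : ℝ → ℝ → ℝ}
    (hf : AEMeasurable (Function.uncurry f) (volume.restrict I2))
    (h1 : vSharp1 f 1 ≠ ∞) (h2 : vSharp2 f 1 ≠ ∞) : IntegrableOn (Function.uncurry f) I2 := by
  refine IntegrableOn.of_bound (by rw [volume_I2]; simp) hf.aestronglyMeasurable
    (|f 0 0| + (vSharp2 f 1).toReal + (vSharp1 f 1).toReal) ?_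
  refine (ae_restrict_iff' measurableSet_I2).2 (Eventually.of_forall fun p hp => ?_)
  have a1 := abs_sub_le_vSharp1_one h1 hp.1 zero_mem_I hp.2
  have a2 : |f 0 p.2 - f 0 0| ≤ (vSharp2 f 1).toReal :=
    abs_sub_le_vSharp1_one (f := fun s t => f t s) h2 hp.2 zero_mem_I zero_mem_I
  have a3 := abs_add_three (f p.1 p.2 - f 0 p.2) (f 0 p.2 - f 0 0) (f 0 0)
  rw [sub_add_sub_cancel, sub_add_cancel] at a3
  rw [Real.norm_eq_abs]
  change |f p.1 p.2| ≤ _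
  linarith

lemma ae_gridPoint_notMem_oppositeSet (R S : ℕ) (x y : ℝ) :
    ∀ᵐ p ∂(volume : Measure (ℝ × ℝ)).restrict I2, p ∈ I2 ∧
      (∀ a, gridPoint R p.1 a ∉ oppositeSet x) ∧ ∀ b, gridPoint S p.2 b ∉ oppositeSet y := by
  have hv : (volume : Measure (ℝ × ℝ)) = volume.prod volume := rfl
  have h1 : ∀ᵐ p ∂(volume : Measure (ℝ × ℝ)), ∀ a, gridPoint R p.1 a ∉ oppositeSet x := by
    rw [hv]
    refine Measure.quasiMeasurePreserving_fst.ae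
      (p := fun θ => ∀ a, gridPoint R θ a ∉ oppositeSet x) ?_
    filter_upwards [(countable_gridPoint_mem_oppositeSet R x).ae_notMem volume] with θ hθ a ha
    exact hθ ⟨a, ha⟩
  have h2 : ∀ᵐ p ∂(volume : Measure (ℝ × ℝ)), ∀ b, gridPoint S p.2 b ∉ oppositeSet y := by
    rw [hv]
    refine Measure.quasiMeasurePreserving_snd.ae
      (p := fun θ => ∀ b, gridPoint S θ b ∉ oppositeSet y) ?_
    filter_upwards [(countable_gridPoint_mem_oppositeSet S y).ae_notMem volume] with θ hθ a ha
    exact hθ ⟨a, ha⟩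
  filter_upwards [ae_restrict_mem measurableSet_I2, ae_restrict_of_ae h1, ae_restrict_of_ae h2]
    with p hp hp1 hp2
  exact ⟨hp, hp1, hp2⟩

lemma exists_two_pow_le {n : ℕ} (hn : 2 ≤ n) : ∃ r, 2 ^ (r + 1) ≤ n ∧ n < 2 ^ (r + 2) := by
  have h0 : n ≠ 0 := by omega
  have h1 := Nat.pow_log_le_self 2 h0
  have h2 := Nat.lt_pow_succ_log_self one_lt_two n
  have h3 : 0 < Nat.log 2 n := Nat.log_pos one_lt_two hn
  obtain ⟨r, hr⟩ := Nat.exists_eq_succ_of_ne_zero h3.ne'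
  rw [hr] at h1 h2
  exact ⟨r, h1, h2⟩

/-- The main estimate: the deviation of the Cesàro mean is small once both indices are large. -/
lemma exists_abs_cesaroMean_sub_le {α β : ℝ} (hα : α ∈ Ioo (0 : ℝ) 1) (hβ : β ∈ Ioo (0 : ℝ) 1)
    (hαβ : α + β < 1) {f : ℝ → ℝ → ℝ}
    (hf : AEMeasurable (Function.uncurry f) (volume.restrict I2))
    (h1 : ∑' j : ℕ, vSharp1 f (2 ^ (j + 1)) /
      ENNReal.ofReal ((2 : ℝ) ^ (((j : ℝ) + 1) * (1 - (α + β)))) < ∞)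
    (h2 : ∑' j : ℕ, vSharp2 f (2 ^ (j + 1)) /
      ENNReal.ofReal ((2 : ℝ) ^ (((j : ℝ) + 1) * (1 - (α + β)))) < ∞)
    {x y : ℝ} (hx : x ∈ I) (hy : y ∈ I) (hc : DyadicContinuousAt f x y) {ε : ℝ} (hε : 0 < ε) :
    ∃ N : ℕ, ∀ n m, N ≤ n → N ≤ m → |cesaroMean (-α) (-β) f n m x y - f x y| ≤ ε := by
  have hfin1 := vSharp1_ne_top h1
  have hfin2 : ∀ p, vSharp1 (fun s t => f t s) (2 ^ p) ≠ ∞ := vSharp1_ne_top h2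
  have hint : IntegrableOn (Function.uncurry f) I2 :=
    integrableOn_of_vSharp hf (by simpa using hfin1 0) (by simpa [vSharp2_eq] using hfin2 0)
  have hw0 : (0 : ℝ) < 2 ^ (α + β - 1) := by positivity
  have hw1 : (2 : ℝ) ^ (α + β - 1) < 1 :=
    Real.rpow_lt_one_of_one_lt_of_neg one_lt_two (by linarith)
  have hs1 := summable_sum_range_mul_pow (fun _ => ENNReal.toReal_nonneg) hw0 hw1
    (summable_vSharp1 h1)
  have hs2 := summable_sum_range_mul_pow (fun _ => ENNReal.toReal_nonneg) hw0 hw1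
    (summable_vSharp1 (f := fun s t => f t s) h2)
  obtain ⟨C, hC, hCk⟩ := exists_abs_kernelTail_le hα
  obtain ⟨C', hC', hCk'⟩ := exists_abs_kernelTail_le hβ
  have two_mul_rate : ∀ a : ℝ, 2 * (2 : ℝ) ^ (a - 1) = 2 ^ a := by
    intro a
    rw [Real.rpow_sub two_pos, Real.rpow_one]; field_simp
  set ρ : ℝ := 2 ^ (α - 1) with hρdef
  set ρ' : ℝ := 2 ^ (β - 1) with hρ'def
  have hρ : 1 < 2 * ρ := by rw [two_mul_rate]; exact Real.one_lt_rpow one_lt_two hα.1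
  have hρ' : 1 < 2 * ρ' := by rw [two_mul_rate]; exact Real.one_lt_rpow one_lt_two hβ.1
  have hρ1 : ρ ≤ 1 := Real.rpow_le_one_of_one_le_of_nonpos one_le_two (by linarith [hα.2])
  have hρ'1 : ρ' ≤ 1 := Real.rpow_le_one_of_one_le_of_nonpos one_le_two (by linarith [hβ.2])
  -- The rate of the kernel weights is exactly the weight in the hypothesis.
  have hρρ : 2 * ρ * ρ' = 2 ^ (α + β - 1) := by
    rw [two_mul_rate, ← Real.rpow_add two_pos]; congr 1; ring
  set κ : ℝ := 2 * (1 + 2 * ρ / (2 * (2 * ρ - 1))) with hκ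
  set κ' : ℝ := 2 * (1 + 2 * ρ' / (2 * (2 * ρ' - 1))) with hκ'
  have hκ0 : 0 < κ := by have : 0 < 2 * ρ - 1 := by linarith
                         positivity
  have hκ'0 : 0 < κ' := by have : 0 < 2 * ρ' - 1 := by linarith
                           positivity
  -- The cutoff `L` is fixed first, from the convergent series; only then is continuity applied to
  -- the corner of fixed size `2^L`. Each of the three parts receives `ε/3`.
  obtain ⟨L₁, hL₁⟩ := exists_sum_ite_lt (fun a => mul_nonneg (Finset.sum_nonneg
    fun _ _ => ENNReal.toReal_nonneg) (by positivity)) hs1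
    (by positivity : 0 < ε / (3 * (C * C') * κ'))
  obtain ⟨L₂, hL₂⟩ := exists_sum_ite_lt (fun a => mul_nonneg (Finset.sum_nonneg
    fun _ _ => ENNReal.toReal_nonneg) (by positivity)) hs2
    (by positivity : 0 < ε / (3 * (C * C') * κ))
  set L := max L₁ L₂ with hL
  obtain ⟨N, hN⟩ := hc.exists_abs_sub_le hx hy
    (by positivity : 0 < ε / (3 * (C * C') * (2 ^ L * (2 ^ L * 4)))) L
  -- This makes both grid exponents exceed `N` and `L`, and both indices at least 2.
  refine ⟨2 ^ (N + L + 1), fun n m hn hm => ?_⟩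
  have htwo : 2 ≤ 2 ^ (N + L + 1) := by
    calc 2 = 2 ^ 1 := rfl
      _ ≤ _ := Nat.pow_le_pow_right two_pos (by omega)
  obtain ⟨r, hr1, hr2⟩ := exists_two_pow_le (htwo.trans hn)
  obtain ⟨s, hs1', hs2'⟩ := exists_two_pow_le (htwo.trans hm)
  have hNr : N + L + 1 < r + 2 := (Nat.pow_lt_pow_iff_right one_lt_two).1 (hn.trans_lt hr2)
  have hNs : N + L + 1 < s + 2 := (Nat.pow_lt_pow_iff_right one_lt_two).1 (hm.trans_lt hs2')
  rw [cesaroMean_sub_eq_integral hα hβ hint (by omega) (by omega) hr2.le hs2'.le hx hy,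
    ← Real.norm_eq_abs]
  have hbound : ∀ᵐ p ∂(volume : Measure (ℝ × ℝ)).restrict I2,
      ‖∑ i ∈ Finset.range (2 ^ (r + 2)), ∑ j ∈ Finset.range (2 ^ (s + 2)),
        (f (gridPoint (r + 2) p.1 (i ^^^ gridIndex (r + 2) x))
          (gridPoint (s + 2) p.2 (j ^^^ gridIndex (s + 2) y)) - f x y) *
          (gridKernel α n (r + 2) i * gridKernel β m (s + 2) j)‖ ≤ ε := by
    filter_upwards [ae_gridPoint_notMem_oppositeSet (r + 2) (s + 2) x y] with p hp
    obtain ⟨⟨hp1, hp2⟩, hpx, hpy⟩ := hp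
    rw [Real.norm_eq_abs]
    have hξ := gridIndex_lt (R := r + 2) hx
    have hη := gridIndex_lt (R := s + 2) hy
    refine (abs_sum_sum_le (L := L)
      (U := fun a => ∑ q ∈ Finset.range a, (vSharp1 f (2 ^ q)).toReal)
      (U' := fun a => ∑ q ∈ Finset.range a, (vSharp1 (fun s t => f t s) (2 ^ q)).toReal)
      hρ hρ1 hρ' hρ'1 hC.le hC'.le (by omega) (by omega)
      (fun i hi => hCk r n i hr1 hr2 hi) (fun j hj => hCk' s m j hs1' hs2' hj) ?_ ?_
      (fun i j hi hj => hN (r + 2) (s + 2) (by omega) (by omega) (by omega) (by omega)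
        p.1 hp1 p.2 hp2 i j hi hj (hpx _) (hpy _))).trans ?_
    · intro a ha j hj
      -- The constant `f x y` drops out of differences, so only the variation of `f` enters.
      simp only [sub_sub_sub_cancel_right]
      exact sum_Ico_abs_sub_le hfin1 ha hξ hp1 (gridPoint_mem_I hp2 (Nat.xor_lt_two_pow hj hη))
    · intro a ha i hi
      simp only [sub_sub_sub_cancel_right]
      exact sum_Ico_abs_sub_le (f := fun s t => f t s) hfin2 ha hη hp2
        (gridPoint_mem_I hp1 (Nat.xor_lt_two_pow hi hξ))
    · rw [hρρ, ← hκ, ← hκ']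
      have b1 := hL₁ L (le_max_left _ _) (r + 2 + 1)
      have b2 := hL₂ L (le_max_right _ _) (s + 2 + 1)
      calc _ ≤ C * C' * (2 ^ L * (2 ^ L * (4 * (ε / (3 * (C * C') * (2 ^ L * (2 ^ L * 4)))))) +
            κ' * (ε / (3 * (C * C') * κ')) + κ * (ε / (3 * (C * C') * κ))) := by gcongr
        _ = ε := by field_simp; ring
  refine (norm_setIntegral_le_of_norm_le_const_ae (by rw [volume_I2]; simp) hbound).trans ?_
  rw [Measure.real, volume_I2]
  simp

end DoubleWalsh

theorem mainTheorem6 (α β : ℝ) (hα : α ∈ Set.Ioo (0 : ℝ) 1) (hβ : β ∈ Set.Ioo (0 : ℝ) 1)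
    (hαβ : α + β < 1) (f : ℝ → ℝ → ℝ)
    (hf : AEMeasurable (Function.uncurry f) (volume.restrict DoubleWalsh.I2))
    (h1 : ∑' j : ℕ, DoubleWalsh.vSharp1 f (2 ^ (j + 1)) /
      ENNReal.ofReal ((2 : ℝ) ^ (((j : ℝ) + 1) * (1 - (α + β)))) < ∞)
    (h2 : ∑' j : ℕ, DoubleWalsh.vSharp2 f (2 ^ (j + 1)) /
      ENNReal.ofReal ((2 : ℝ) ^ (((j : ℝ) + 1) * (1 - (α + β)))) < ∞)
    (x y : ℝ) (hx : x ∈ DoubleWalsh.I) (hy : y ∈ DoubleWalsh.I)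
    (hc : DoubleWalsh.DyadicContinuousAt f x y) :
    Tendsto (fun q : ℕ × ℕ => DoubleWalsh.cesaroMean (-α) (-β) f q.1 q.2 x y)
      (atTop ×ˢ atTop) (𝓝 (f x y)) := by
  rw [Metric.tendsto_nhds]
  intro ε hε
  obtain ⟨N, hN⟩ := DoubleWalsh.exists_abs_cesaroMean_sub_le hα hβ hαβ hf h1 h2 hx hy hc
    (half_pos hε)
  filter_upwards [(eventually_ge_atTop N).prod_mk (eventually_ge_atTop N)] with q hq
  rw [Real.dist_eq]
  exact (hN q.1 q.2 hq.1 hq.2).trans_lt (half_lt_self hε)
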